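/- Let $\omega$ be a free ultrafilter on $\mathbb N$, let $G$ be a compact group, let $A$ be a unital separable C*-algebra and let $\alpha:G\to\operatorname{Aut}(A)$ be a (point-norm) continuous action. Let $A_\omega=\ell^\infty(\mathbb N,A)/\{(a_n):\lim_\omega\|a_n\|=0\}$ be the ultrapower, with $A\subset A_\omega$ as constant sequences, and let $\alpha_\omega$ be the action induced by $\alpha$ on $A_\omega$ and on $A_\omega\cap A'$. Let $\sigma$ be the shift action on $C(G)$, $\sigma_g(f)(h)=f(g^{-1}h)$. For positive elements $a,b$ of a C*-algebra $D$ write $a\lesssim b$ if $x_nbx_n^*\to a$ in norm for some sequence $(x_n)$ in $D$. An order zero map is a completely positive linear map $\varphi$ between C*-algebras such that $\varphi(a)\varphi(b)=\varphi(b)\varphi(a)=0$ whenever $a,b\ge 0$ and $ab=ba=0$. The action $\alpha$ has the weak tracial Rokhlin property if for every nonzero positive $x\in A_\omega$ there is a contractive equivariant order zero map $\varphi:(C(G),\sigma)\to(A_\omega\cap A',\alpha_\omega)$ with $1-\varphi(1_{C(G)})\lesssim x$ in $A_\omega$. For an action $\beta$ of $G$ on a unital C*-algebra $B$, an equivariant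 $*$-homomorphism $\phi:(A,\alpha)\to(B,\beta)$ is $G$-tracially sequentially-split by order zero if for every nonzero positive $x\in A_\omega$ there are an equivariant order zero map $\psi:(B,\beta)\to(A_\omega,\alpha_\omega)$ and a positive element $e\in A_\omega\cap A'$ such that $\psi(\phi(a))=ea=ae$ for all $a\in A$ and $1-e\lesssim x$ in $A_\omega$ (where $\lesssim$ includes the requirement $1-e\ge 0$). Then $\alpha$ has the weak tracial Rokhlin property if and only if the map $$1_{C(G)}\otimes\operatorname{id}_A:(A,\alpha)\to(C(G)\otimes A,\sigma\otimes\alpha),\qquad a\mapsto 1\otimes a,$$ is $G$-tracially sequentially-split by order zero. Here $C(G)\otimes A$ is identified with $C(G,A)$, and $((\sigma\otimes\alpha)_gF)(h)=\alpha_g(F(g^{-1}h))$. -/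

import Mathlib

open Filter Topology
open scoped BoundedContinuousFunction TensorProduct

noncomputable section

namespace CStarDyn

/-! ## Positivity, Cuntz subequivalence and order zero maps

The order on a C*-algebra is the usual one: `0 ≤ a` iff `a` is self-adjoint with nonnegative
spectrum. -/

section Generic

attribute [local instance] CStarAlgebra.spectralOrder CStarAlgebra.spectralOrderedRing

variable {A B : Type*} [CStarAlgebra A] [CStarAlgebra B]

/-- `a` is a positive element of the C*-algebra `A`. -/
def IsPos (a : A) : Prop := 0 ≤ a

/-- `a` and `b` are positive and `a` is Cuntz subequivalent to `b` in `A`: there is a sequence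
`x` in `A` with `x n * b * (x n)* → a` in norm. -/
def CuntzLE (a b : A) : Prop :=
  IsPos a ∧ IsPos b ∧ ∃ x : ℕ → A, Tendsto (fun n => x n * b * star (x n)) atTop (𝓝 a)

variable (A B) in
/-- Order zero maps: completely positive linear maps which preserve orthogonality of positive
elements. -/
structure OrderZeroMap extends CompletelyPositiveMap A B where
  map_orthogonal' : ∀ a b : A, IsPos a → IsPos b → a * b = 0 → b * a = 0 →
    toLinearMap a * toLinearMap b = 0 ∧ toLinearMap b * toLinearMap a = 0

instance : CoeFun (OrderZeroMap A B) (fun _ => A → B) := ⟨fun φ => φ.toLinearMap⟩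

/-- `φ` is contractive: `‖φ a‖ ≤ ‖a‖`. -/
def OrderZeroMap.IsContractive (φ : OrderZeroMap A B) : Prop := ∀ a : A, ‖φ a‖ ≤ ‖a‖

end Generic

/-! ## The ultrapower -/

section Ultrapower

variable (ω : Ultrafilter ℕ) (A : Type*) [CStarAlgebra A]

/-- The C*-algebra `ℓ^∞(ℕ, A)` of bounded sequences in `A` (every function on the discrete
space `ℕ` is continuous). -/
abbrev LInfty : Type _ := ℕ →ᵇ A

/-- The ideal `c_ω(ℕ, A)` of bounded sequences whose norms converge to `0` along `ω`. -/
def cOmega : Ideal (LInfty A) where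
  carrier := {f | Tendsto (fun n => ‖f n‖) ω (𝓝 0)}
  zero_mem' := by simp
  add_mem' {f g} hf hg := by
    refine squeeze_zero (fun _ => norm_nonneg _) (fun n => ?_) (by simpa using hf.add hg)
    simpa using norm_add_le (f n) (g n)
  smul_mem' c f hf := by
    refine squeeze_zero (fun _ => norm_nonneg _) (fun n => ?_)
      (by simpa using hf.const_mul ‖c‖)
    exact (norm_mul_le _ _).trans
      (mul_le_mul_of_nonneg_right (c.norm_coe_le_norm n) (norm_nonneg _))

variable {A} in
theorem mem_cOmega {f : LInfty A} : f ∈ cOmega ω A ↔ Tendsto (fun n => ‖f n‖) ω (𝓝 0) := Iff.rfl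

instance : (cOmega ω A).IsTwoSided where
  mul_mem_of_left {f} c hf := by
    rw [mem_cOmega] at hf ⊢
    refine squeeze_zero (fun _ => norm_nonneg _) (fun n => ?_)
      (by simpa using hf.mul_const ‖c‖)
    exact (norm_mul_le _ _).trans
      (mul_le_mul_of_nonneg_left (c.norm_coe_le_norm n) (norm_nonneg _))

variable {A} in
theorem star_mem_cOmega {f : LInfty A} (hf : f ∈ cOmega ω A) : star f ∈ cOmega ω A := by
  rw [mem_cOmega] at hf ⊢
  simpa using hf

/-- The ultrapower `A_ω = ℓ^∞(ℕ, A) / c_ω(ℕ, A)`. -/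
def Ultrapower : Type _ := LInfty A ⧸ cOmega ω A

namespace Ultrapower

instance : Ring (Ultrapower ω A) := inferInstanceAs (Ring (LInfty A ⧸ cOmega ω A))

instance : Algebra ℂ (Ultrapower ω A) := inferInstanceAs (Algebra ℂ (LInfty A ⧸ cOmega ω A))

variable {A} in
/-- The quotient map `π_ω : ℓ^∞(ℕ, A) → A_ω`. -/
def mk : LInfty A →ₐ[ℂ] Ultrapower ω A := Ideal.Quotient.mkₐ ℂ (cOmega ω A)

variable {A} in
theorem mk_surjective : Function.Surjective (mk ω : LInfty A → Ultrapower ω A) :=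
  Ideal.Quotient.mk_surjective

variable {A} in
theorem mk_eq_mk {f g : LInfty A} : mk ω f = mk ω g ↔ f - g ∈ cOmega ω A :=
  Ideal.Quotient.eq

variable {A} in
/-- Along an ultrafilter the norms of a bounded sequence converge. -/
theorem exists_tendsto_norm (f : LInfty A) : ∃ L : ℝ, Tendsto (fun n => ‖f n‖) ω (𝓝 L) := by
  have h : (ω.map (fun n => ‖f n‖) : Filter ℝ) ≤ 𝓟 (Set.Icc 0 ‖f‖) := by
    rw [Filter.le_principal_iff]
    exact Filter.Eventually.of_forall (f := (ω : Filter ℕ))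
      fun n => (⟨norm_nonneg _, f.norm_coe_le_norm n⟩ : ‖f n‖ ∈ Set.Icc 0 ‖f‖)
  obtain ⟨L, -, hL⟩ := (isCompact_Icc (a := (0 : ℝ)) (b := ‖f‖)).ultrafilter_le_nhds _ h
  exact ⟨L, hL⟩

variable {A} in
theorem norm_limit_unique {f g : LInfty A} (h : mk ω f = mk ω g) {L : ℝ}
    (hf : Tendsto (fun n => ‖f n‖) ω (𝓝 L)) : Tendsto (fun n => ‖g n‖) ω (𝓝 L) := by
  have h0 : Tendsto (fun n => ‖f n - g n‖) ω (𝓝 0) := (mk_eq_mk ω).1 h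
  have h1 : Tendsto (fun n => ‖g n‖ - ‖f n‖) ω (𝓝 0) := by
    refine squeeze_zero_norm (fun n => ?_) h0
    rw [Real.norm_eq_abs, norm_sub_rev]
    exact abs_norm_sub_norm_le _ _
  simpa using h1.add hf

theorem isClosed_cOmega : IsClosed (cOmega ω A : Set (LInfty A)) := by
  refine isClosed_of_closure_subset fun f hf => ?_
  rw [Metric.mem_closure_iff] at hf
  obtain ⟨L, hL⟩ := exists_tendsto_norm ω f
  have hL0 : L = 0 := by
    refine le_antisymm (le_of_forall_pos_le_add fun ε hε => ?_)
      (ge_of_tendsto hL (Eventually.of_forall fun _ => norm_nonneg _))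
    obtain ⟨g, hg, hfg⟩ := hf ε hε
    have hg' : Tendsto (fun n => ‖g n‖ + ε) ω (𝓝 (0 + ε)) := Tendsto.add_const _ hg
    refine le_of_tendsto_of_tendsto hL hg' (Eventually.of_forall fun n => ?_)
    have h1 : ‖f n - g n‖ ≤ ε := by
      have := (f - g).norm_coe_le_norm n
      rw [dist_eq_norm] at hfg
      exact this.trans hfg.le
    have := norm_add_le (g n) (f n - g n)
    rw [add_sub_cancel] at this
    linarith
  rw [hL0] at hL
  exact hL

instance : NormedAddCommGroup (Ultrapower ω A) :=
  haveI := isClosed_cOmega ω A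
  inferInstanceAs (NormedAddCommGroup (LInfty A ⧸ cOmega ω A))

instance : CompleteSpace (Ultrapower ω A) :=
  inferInstanceAs (CompleteSpace (LInfty A ⧸ cOmega ω A))

instance : NormedSpace ℂ (Ultrapower ω A) :=
  haveI := isClosed_cOmega ω A
  inferInstanceAs (NormedSpace ℂ (LInfty A ⧸ cOmega ω A))

variable {A} in
/-- The quotient norm is `‖[f]‖ = lim_ω ‖f n‖`. -/
theorem tendsto_norm_mk (f : LInfty A) : Tendsto (fun n => ‖f n‖) ω (𝓝 ‖mk ω f‖) := by
  obtain ⟨L, hL⟩ := exists_tendsto_norm ω f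
  suffices h : ‖mk ω f‖ = L by rwa [h]
  apply le_antisymm
  · refine le_of_forall_pos_le_add fun ε hε => ?_
    classical
    have hL0 : 0 ≤ L := ge_of_tendsto hL (Eventually.of_forall fun _ => norm_nonneg _)
    let g : LInfty A := BoundedContinuousFunction.ofNormedAddCommGroupDiscrete
      (fun n => if ‖f n‖ < L + ε then f n else 0) (L + ε) (fun n => by
        split_ifs with h
        · exact h.le
        · rw [norm_zero]; positivity)
    have hg : ‖g‖ ≤ L + ε := by
      refine (BoundedContinuousFunction.norm_le (by positivity)).2 fun n => ?_
      change ‖(if ‖f n‖ < L + ε then f n else 0 : A)‖ ≤ _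
      split_ifs with h
      · exact h.le
      · rw [norm_zero]; positivity
    have hfg : mk ω f = mk ω g := by
      rw [mk_eq_mk, mem_cOmega]
      have hev : ∀ᶠ n in (ω : Filter ℕ), ‖f n‖ < L + ε := hL.eventually_lt_const (by linarith)
      refine tendsto_const_nhds.congr' ?_
      filter_upwards [hev] with n hn
      have hgn : g n = f n := if_pos hn
      rw [BoundedContinuousFunction.coe_sub, Pi.sub_apply, hgn, sub_self, norm_zero]
    rw [hfg]
    exact (Submodule.Quotient.norm_mk_le (cOmega ω A) g).trans hg
  · refine le_of_forall_pos_le_add fun ε hε => ?_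
    obtain ⟨g, hg, hlt⟩ := Submodule.Quotient.norm_mk_lt (S := cOmega ω A) (mk ω f) hε
    have hL' := norm_limit_unique ω (f := f) (g := g) hg.symm hL
    refine le_of_tendsto hL' (Eventually.of_forall fun n => ?_)
    exact (g.norm_coe_le_norm n).trans hlt.le

instance : NormedRing (Ultrapower ω A) where
  dist_eq := dist_eq_norm_neg_add
  norm_mul_le x y := by
    obtain ⟨f, rfl⟩ := mk_surjective ω x
    obtain ⟨g, rfl⟩ := mk_surjective ω y
    rw [← map_mul]
    exact le_of_tendsto_of_tendsto (tendsto_norm_mk ω (f * g))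
      ((tendsto_norm_mk ω f).mul (tendsto_norm_mk ω g))
      (Eventually.of_forall fun n => norm_mul_le _ _)

instance : StarRing (Ultrapower ω A) where
  star := Quotient.map' star fun f g h => by
    rw [Submodule.quotientRel_def] at h ⊢
    rw [← star_sub]
    exact star_mem_cOmega ω h
  star_involutive x := by
    obtain ⟨f, rfl⟩ := mk_surjective ω x
    exact congrArg (mk ω) (star_star f)
  star_mul x y := by
    obtain ⟨f, rfl⟩ := mk_surjective ω x
    obtain ⟨g, rfl⟩ := mk_surjective ω y
    exact congrArg (mk ω) (star_mul f g)
  star_add x y := by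
    obtain ⟨f, rfl⟩ := mk_surjective ω x
    obtain ⟨g, rfl⟩ := mk_surjective ω y
    exact congrArg (mk ω) (star_add f g)

variable {A} in
theorem star_mk (f : LInfty A) : star (mk ω f) = mk ω (star f) := rfl

instance : CStarAlgebra (Ultrapower ω A) where
  norm_smul_le := norm_smul_le
  norm_mul_self_le x := by
    obtain ⟨f, rfl⟩ := mk_surjective ω x
    rw [star_mk, ← map_mul]
    refine le_of_tendsto_of_tendsto ((tendsto_norm_mk ω f).mul (tendsto_norm_mk ω f))
      (tendsto_norm_mk ω (star f * f)) (Eventually.of_forall fun n => ?_)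
    exact (CStarRing.norm_star_mul_self (x := f n)).symm.le
  star_smul c x := by
    obtain ⟨f, rfl⟩ := mk_surjective ω x
    rw [← map_smul, star_mk, star_mk, star_smul, map_smul]

variable {A}

/-- The embedding `ι : A → A_ω` as constant sequences. -/
def const (a : A) : Ultrapower ω A := mk ω (BoundedContinuousFunction.const ℕ a)

variable (A) in
/-- The commutant of (the image of) `A` in `A_ω`, i.e. the central ultrapower `A_ω ∩ A'`. -/
def central : StarSubalgebra ℂ (Ultrapower ω A) :=
  StarSubalgebra.centralizer ℂ (Set.range (const ω : A → Ultrapower ω A))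

theorem star_const (a : A) : star (const ω a) = const ω (star a) := rfl

theorem mem_central {x : Ultrapower ω A} :
    x ∈ central ω A ↔ ∀ a : A, const ω a * x = x * const ω a := by
  rw [central, StarSubalgebra.mem_centralizer_iff]
  constructor
  · rintro h a
    exact (h _ ⟨a, rfl⟩).1
  · rintro h _ ⟨a, rfl⟩
    exact ⟨h a, by rw [star_const]; exact h _⟩

instance isClosed_central : IsClosed (central ω A : Set (Ultrapower ω A)) := by
  have : (central ω A : Set (Ultrapower ω A)) =
      ⋂ a : A, {x | const ω a * x = x * const ω a} := by
    ext x
    simp [mem_central]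
  rw [this]
  exact isClosed_iInter fun a =>
    isClosed_eq (by fun_prop) (by fun_prop)

/-- An automorphism of `A` applied entrywise to a bounded sequence. -/
def seqMap (e : A ≃⋆ₐ[ℂ] A) (f : LInfty A) : LInfty A :=
  BoundedContinuousFunction.ofNormedAddCommGroupDiscrete (fun n => e (f n)) ‖f‖ fun n =>
    (NonUnitalStarAlgHom.norm_apply_le e (f n)).trans (f.norm_coe_le_norm n)

theorem seqMap_sub_mem (e : A ≃⋆ₐ[ℂ] A) {f g : LInfty A} (h : f - g ∈ cOmega ω A) :
    seqMap e f - seqMap e g ∈ cOmega ω A := by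
  rw [mem_cOmega] at h ⊢
  refine squeeze_zero (fun _ => norm_nonneg _) (fun n => ?_) h
  change ‖e (f n) - e (g n)‖ ≤ ‖f n - g n‖
  rw [← map_sub]
  exact NonUnitalStarAlgHom.norm_apply_le e _

/-- The map `A_ω → A_ω`, `[(a_n)] ↦ [(e a_n)]` induced by an automorphism `e` of `A`. -/
def mapFun (e : A ≃⋆ₐ[ℂ] A) : Ultrapower ω A → Ultrapower ω A :=
  Quotient.map' (seqMap e) fun f g h => by
    rw [Submodule.quotientRel_def] at h ⊢
    exact seqMap_sub_mem ω e h

theorem mapFun_mk (e : A ≃⋆ₐ[ℂ] A) (f : LInfty A) : mapFun ω e (mk ω f) = mk ω (seqMap e f) := rfl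

/-- The automorphism of `A_ω` induced by an automorphism of `A`. -/
def mapAut (e : A ≃⋆ₐ[ℂ] A) : Ultrapower ω A ≃⋆ₐ[ℂ] Ultrapower ω A where
  toFun := mapFun ω e
  invFun := mapFun ω e.symm
  left_inv x := by
    obtain ⟨f, rfl⟩ := mk_surjective ω x
    exact congrArg (mk ω) (BoundedContinuousFunction.ext fun n => e.symm_apply_apply (f n))
  right_inv x := by
    obtain ⟨f, rfl⟩ := mk_surjective ω x
    exact congrArg (mk ω) (BoundedContinuousFunction.ext fun n => e.apply_symm_apply (f n))
  map_mul' x y := by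
    obtain ⟨f, rfl⟩ := mk_surjective ω x
    obtain ⟨g, rfl⟩ := mk_surjective ω y
    exact congrArg (mk ω) (BoundedContinuousFunction.ext fun n => map_mul e (f n) (g n))
  map_add' x y := by
    obtain ⟨f, rfl⟩ := mk_surjective ω x
    obtain ⟨g, rfl⟩ := mk_surjective ω y
    exact congrArg (mk ω) (BoundedContinuousFunction.ext fun n => map_add e (f n) (g n))
  map_star' x := by
    obtain ⟨f, rfl⟩ := mk_surjective ω x
    exact congrArg (mk ω) (BoundedContinuousFunction.ext fun n => map_star e (f n))
  map_smul' c x := by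
    obtain ⟨f, rfl⟩ := mk_surjective ω x
    exact congrArg (mk ω) (BoundedContinuousFunction.ext fun n => map_smul e c (f n))

theorem mapAut_mk (e : A ≃⋆ₐ[ℂ] A) (f : LInfty A) : mapAut ω e (mk ω f) = mk ω (seqMap e f) := rfl

end Ultrapower

end Ultrapower

/-! ## Actions -/

section Actions

/-- A (point-norm) continuous action of `G` on the C*-algebra `A`. -/
structure Action (G A : Type*) [Group G] [TopologicalSpace G] [CStarAlgebra A] where
  toHom : G →* (A ≃⋆ₐ[ℂ] A)
  continuous_orbit : ∀ a : A, Continuous fun g => toHom g a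

variable {G A B : Type*} [Group G] [TopologicalSpace G] [CStarAlgebra A] [CStarAlgebra B]

instance : CoeFun (Action G A) (fun _ => G → (A ≃⋆ₐ[ℂ] A)) := ⟨fun α => α.toHom⟩

/-- The induced action `α_ω` of `G` on `A_ω` (not continuous in general). -/
def Action.ultra (ω : Ultrafilter ℕ) (α : Action G A) :
    G →* (Ultrapower ω A ≃⋆ₐ[ℂ] Ultrapower ω A) where
  toFun g := Ultrapower.mapAut ω (α g)
  map_one' := by
    ext x
    obtain ⟨f, rfl⟩ := Ultrapower.mk_surjective ω x
    refine congrArg (Ultrapower.mk ω) (BoundedContinuousFunction.ext fun n => ?_)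
    change α.toHom 1 (f n) = f n
    rw [map_one]
    rfl
  map_mul' g h := by
    ext x
    obtain ⟨f, rfl⟩ := Ultrapower.mk_surjective ω x
    refine congrArg (Ultrapower.mk ω) (BoundedContinuousFunction.ext fun n => ?_)
    change α.toHom (g * h) (f n) = α.toHom g (α.toHom h (f n))
    rw [map_mul]
    rfl

/-- `α_ω` preserves the central ultrapower. -/
theorem Action.ultra_mem_central (ω : Ultrafilter ℕ) (α : Action G A) (g : G)
    {x : Ultrapower ω A} (hx : x ∈ Ultrapower.central ω A) :
    α.ultra ω g x ∈ Ultrapower.central ω A := by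
  rw [Ultrapower.mem_central] at hx ⊢
  intro a
  have h : Ultrapower.const ω a = α.ultra ω g (Ultrapower.const ω (α.toHom g⁻¹ a)) := by
    refine congrArg (Ultrapower.mk ω) (BoundedContinuousFunction.ext fun n => ?_)
    change a = (α.toHom g * α.toHom g⁻¹) a
    rw [← map_mul, mul_inv_cancel, map_one]
    rfl
  rw [h, ← map_mul, ← map_mul, hx]

/-- The action induced by `α` on the central ultrapower, again denoted `α_ω`. -/
def Action.ultraCentral (ω : Ultrafilter ℕ) (α : Action G A) (g : G)
    (x : Ultrapower.central ω A) : Ultrapower.central ω A :=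
  ⟨α.ultra ω g x, α.ultra_mem_central ω g x.2⟩

theorem Action.continuous_uncurry (α : Action G A) :
    Continuous fun p : G × A => α p.1 p.2 := by
  rw [continuous_iff_continuousAt]
  rintro ⟨g, a⟩
  rw [ContinuousAt, tendsto_iff_norm_sub_tendsto_zero]
  have h1 : Tendsto (fun p : G × A => ‖p.2 - a‖ + ‖α p.1 a - α g a‖) (𝓝 (g, a))
      (𝓝 (0 + 0)) := by
    refine Tendsto.add ?_ ?_
    · have : Continuous fun p : G × A => ‖p.2 - a‖ := by fun_prop
      simpa using this.tendsto (g, a)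
    · have : Continuous fun p : G × A => ‖α p.1 a - α g a‖ :=
        (((α.continuous_orbit a).comp continuous_fst).sub continuous_const).norm
      simpa using this.tendsto (g, a)
  rw [add_zero] at h1
  refine squeeze_zero (fun _ => norm_nonneg _) (fun p => ?_) h1
  have h2 : α p.1 p.2 - α g a = α p.1 (p.2 - a) + (α p.1 a - α g a) := by
    rw [map_sub]; abel
  rw [h2]
  exact (norm_add_le _ _).trans (add_le_add (NonUnitalStarAlgHom.norm_apply_le _ _) le_rfl)

variable [IsTopologicalGroup G] [CompactSpace G]

/-- The function `h ↦ α_g (F (g⁻¹ h))`. -/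
def tensorFun (α : Action G A) (g : G) (F : C(G, A)) : C(G, A) where
  toFun h := α g (F (g⁻¹ * h))
  continuous_toFun := α.continuous_uncurry.comp
    (continuous_const.prodMk (F.continuous.comp (continuous_const.mul continuous_id)))

/-- `C(G) ⊗ A` is realised, as usual, as the C*-algebra `C(G, A)` of continuous functions
`G → A` with the supremum norm; the elementary tensor `f ⊗ a` is the function `h ↦ f h • a`.
The lemmas below show that this embeds the algebraic tensor product as a dense subspace. -/
def elemTensor (f : C(G, ℂ)) (a : A) : C(G, A) where
  toFun h := f h • a
  continuous_toFun := f.continuous.smul continuous_const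

variable (G A) in
/-- The canonical map from the algebraic tensor product to `C(G, A)`, `f ⊗ a ↦ (h ↦ f h • a)`. -/
def algTensorMap : TensorProduct ℂ C(G, ℂ) A →ₗ[ℂ] C(G, A) :=
  TensorProduct.lift (LinearMap.mk₂ ℂ elemTensor
    (fun _ _ _ => by ext; simp [elemTensor, add_smul])
    (fun _ _ _ => by ext; simp [elemTensor, mul_smul])
    (fun _ _ _ => by ext; simp [elemTensor])
    (fun c f a => by ext h; simp [elemTensor, smul_comm (f h) c a]))

theorem algTensorMap_tmul (f : C(G, ℂ)) (a : A) :
    algTensorMap G A (f ⊗ₜ[ℂ] a) = elemTensor f a := rfl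

theorem algTensorMap_injective : Function.Injective (algTensorMap G A) := by
  rw [injective_iff_map_eq_zero]
  intro t ht
  let b := Module.Basis.ofVectorSpace ℂ A
  obtain ⟨c, rfl⟩ := TensorProduct.eq_repr_basis_right b t
  suffices hc : c = 0 by simp [hc]
  ext i h
  have h1 : ∑ j ∈ c.support, (c j h) • b j = 0 := by
    have := congrArg (fun F : C(G, A) => F h) ht
    simpa [Finsupp.sum, algTensorMap_tmul, elemTensor, ContinuousMap.sum_apply] using this
  by_cases hi : i ∈ c.support
  · exact linearIndependent_iff'.1 b.linearIndependent c.support (fun j => c j h) h1 i hi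
  · simp [Finsupp.notMem_support_iff.1 hi]

theorem algTensorMap_denseRange : DenseRange (algTensorMap G A) := by
  intro F
  rw [Metric.mem_closure_iff]
  intro ε hε
  let U : G → Set G := fun x => F ⁻¹' Metric.ball (F x) (ε / 2)
  have hU : ∀ x, IsOpen (U x) := fun x => Metric.isOpen_ball.preimage F.continuous
  have hcov : (Set.univ : Set G) ⊆ ⋃ x, U x := fun x _ =>
    Set.mem_iUnion.2 ⟨x, Metric.mem_ball_self (half_pos hε)⟩
  obtain ⟨s, hs⟩ := isCompact_univ.elim_finite_subcover U hU hcov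
  obtain ⟨p, hp⟩ := PartitionOfUnity.exists_isSubordinate_of_locallyFinite isClosed_univ
    (fun x : s => U x) (fun x => hU x) (locallyFinite_of_finite _) (fun x hx => by
      have := hs hx
      simp only [Set.mem_iUnion] at this ⊢
      obtain ⟨y, hy, hxy⟩ := this
      exact ⟨⟨y, hy⟩, hxy⟩)
  let q : s → C(G, ℂ) := fun i => ⟨fun h => ((p i h : ℝ) : ℂ), by fun_prop⟩
  refine ⟨algTensorMap G A (∑ i : s, q i ⊗ₜ[ℂ] F i), ⟨_, rfl⟩, ?_⟩
  refine lt_of_le_of_lt ?_ (half_lt_self hε)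
  rw [dist_eq_norm]
  refine (ContinuousMap.norm_le _ (half_pos hε).le).2 fun h => ?_
  have hsum : ∑ i : s, p i h = 1 := by
    rw [← finsum_eq_sum_of_fintype]; exact p.sum_eq_one (Set.mem_univ h)
  have hF : F h = ∑ i : s, ((p i h : ℝ) : ℂ) • F h := by
    rw [← Finset.sum_smul, ← Complex.ofReal_sum, hsum]; simp
  have hd : (F - algTensorMap G A (∑ i : s, q i ⊗ₜ[ℂ] F i)) h =
      ∑ i : s, ((p i h : ℝ) : ℂ) • (F h - F i) := by
    simp only [smul_sub, Finset.sum_sub_distrib, ← hF]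
    simp [algTensorMap_tmul, elemTensor, ContinuousMap.sum_apply, q]
  rw [hd]
  calc ‖∑ i : s, ((p i h : ℝ) : ℂ) • (F h - F i)‖ ≤ ∑ i : s, p i h * (ε / 2) := by
        refine (norm_sum_le _ _).trans (Finset.sum_le_sum fun i _ => ?_)
        rw [norm_smul, Complex.norm_real, Real.norm_eq_abs, abs_of_nonneg (p.nonneg i h)]
        by_cases h0 : p i h = 0
        · simp [h0]
        · have hm : h ∈ U i := hp i (subset_tsupport _ h0)
          have hlt : dist (F h) (F i) < ε / 2 := hm
          rw [dist_eq_norm] at hlt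
          exact mul_le_mul_of_nonneg_left hlt.le (p.nonneg i h)
    _ = ε / 2 := by rw [← Finset.sum_mul, hsum, one_mul]

/-- The action `σ ⊗ α` of `G` on `C(G) ⊗ A = C(G, A)`:
`((σ ⊗ α)_g F) h = α_g (F (g⁻¹ h))`. -/
def tensorAction (α : Action G A) : Action G C(G, A) where
  toHom :=
    { toFun := fun g =>
        { toFun := tensorFun α g
          invFun := tensorFun α g⁻¹
          left_inv := fun F => by
            ext h
            change (α.toHom g⁻¹ * α.toHom g) (F (g⁻¹ * (g⁻¹⁻¹ * h))) = F h
            rw [← map_mul, inv_mul_cancel, map_one, inv_inv, inv_mul_cancel_left]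
            rfl
          right_inv := fun F => by
            ext h
            change (α.toHom g * α.toHom g⁻¹) (F (g⁻¹⁻¹ * (g⁻¹ * h))) = F h
            rw [← map_mul, mul_inv_cancel, map_one, inv_inv, mul_inv_cancel_left]
            rfl
          map_mul' := fun F K => by ext h; exact map_mul (α g) _ _
          map_add' := fun F K => by ext h; exact map_add (α g) _ _
          map_star' := fun F => by ext h; exact map_star (α g) _
          map_smul' := fun c F => by ext h; exact map_smul (α g) c _ }
      map_one' := by
        ext F h
        change α.toHom 1 (F (1⁻¹ * h)) = F h
        rw [map_one, inv_one, one_mul]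
        rfl
      map_mul' := fun g k => by
        ext F h
        change α.toHom (g * k) (F ((g * k)⁻¹ * h)) = α.toHom g (α.toHom k (F (k⁻¹ * (g⁻¹ * h))))
        rw [map_mul, mul_inv_rev, mul_assoc]
        rfl }
  continuous_orbit F := by
    refine ContinuousMap.continuous_of_continuous_uncurry _ ?_
    exact α.continuous_uncurry.comp (continuous_fst.prodMk
      (F.continuous.comp (continuous_fst.inv.mul continuous_snd)))

theorem tensorAction_apply (α : Action G A) (g h : G) (F : C(G, A)) :
    tensorAction α g F h = α g (F (g⁻¹ * h)) := rfl

variable (G) in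
/-- The trivial action on `ℂ`. -/
def trivialAction : Action G ℂ where
  toHom := 1
  continuous_orbit _ := continuous_const

variable (G) in
/-- The shift action `σ` of `G` on `C(G)`: `(σ_g f) h = f (g⁻¹ h)`. -/
def shift : Action G C(G, ℂ) := tensorAction (trivialAction G)

theorem shift_apply (g h : G) (f : C(G, ℂ)) : shift G g f h = f (g⁻¹ * h) := rfl

theorem tensorAction_elemTensor (α : Action G A) (g : G) (f : C(G, ℂ)) (a : A) :
    tensorAction α g (elemTensor f a) = elemTensor (shift G g f) (α g a) := by
  ext h
  exact map_smul (α g) _ _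

variable (G A) in
/-- The *-homomorphism `1_{C(G)} ⊗ id_A : A → C(G) ⊗ A`, `a ↦ 1 ⊗ a`. -/
def oneTensorId : A →⋆ₙₐ[ℂ] C(G, A) where
  toFun a := elemTensor 1 a
  map_smul' c a := by ext h; simp [elemTensor]
  map_zero' := by ext h; simp [elemTensor]
  map_add' a b := by ext h; simp [elemTensor]
  map_mul' a b := by ext h; simp [elemTensor]
  map_star' a := by ext h; simp [elemTensor]

end Actions

/-! ## The two properties -/

section Properties

variable {G A B : Type*} [Group G] [TopologicalSpace G] [CStarAlgebra A] [CStarAlgebra B]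

/-- `φ : (A, α) → (B, β)` is an equivariant *-homomorphism which is `G`-tracially
sequentially-split by order zero. -/
def IsTraciallySequentiallySplit (ω : Ultrafilter ℕ) (α : Action G A) (β : Action G B)
    (φ : A →⋆ₙₐ[ℂ] B) : Prop :=
  (∀ (g : G) (a : A), φ (α g a) = β g (φ a)) ∧
  ∀ x : Ultrapower ω A, IsPos x → x ≠ 0 →
    ∃ (ψ : OrderZeroMap B (Ultrapower ω A)) (e : Ultrapower ω A),
      (∀ (g : G) (b : B), ψ (β g b) = α.ultra ω g (ψ b)) ∧
      IsPos e ∧ e ∈ Ultrapower.central ω A ∧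
      (∀ a : A, ψ (φ a) = e * Ultrapower.const ω a ∧ ψ (φ a) = Ultrapower.const ω a * e) ∧
      CuntzLE (1 - e) x

/-- The weak tracial Rokhlin property of an action of a compact group. -/
def HasWeakTracialRokhlin [IsTopologicalGroup G] [CompactSpace G] (ω : Ultrafilter ℕ)
    (α : Action G A) : Prop :=
  ∀ x : Ultrapower ω A, IsPos x → x ≠ 0 →
    ∃ φ : OrderZeroMap C(G, ℂ) (Ultrapower.central ω A),
      φ.IsContractive ∧
      (∀ (g : G) (f : C(G, ℂ)), φ (shift G g f) = α.ultraCentral ω g (φ f)) ∧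
      CuntzLE (1 - (φ 1 : Ultrapower ω A)) x

end Properties

end CStarDyn

end

/-! The two kinds of map determine each other. A map φ on C(G) yields ψ(f ⊗ a) = φ(f)a, and ψ yields
φ(f) = ψ(f ⊗ 1). In both directions e = φ(1) = ψ(1), so the Cuntz condition on 1 - e carries over
unchanged.

The engine is the identity T(y)T(z) = T(1)T(yz) for commuting positive y, z and a positive linear T
preserving orthogonality (`map_mul_map_of_commute`). It is obtained without the structure theorem
for order zero maps. Slicing y by hat functions of its spectrum makes the defect T(y)T(z) -
T(1)T(yz) a tridiagonal sum with coefficients 0 and ±1, whose norm has a bound free of y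
(`norm_map_mul_map_sub_le`). Replacing y by ny multiplies the defect by n but not the bound, so the
defect is zero.

From φ to ψ: Riemann sums Σ φ(p_i)F(x_i) over partitions of unity give boundedness on the algebraic
tensor product (`norm_tensor_le`) and complete positivity of the extension to C(G, A); the identity
for φ gives orthogonality (`tensor_extension_mul`).

From ψ to φ: evaluating ψ(f ⊗ 1)ψ(1 ⊗ a) in either order shows that e annihilates the commutator z
of a and φ(f). Positivity makes every value of ψ annihilate whatever e does, hence z*z = 0 and φ
takes central values. Contractivity follows from ‖e‖ ≤ 1. -/

noncomputable section

namespace CStarDyn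

/-! ### Norm estimates of Cauchy–Schwarz type for finite sums. -/

section CauchySchwarz

variable {D : Type*} [CStarAlgebra D] [PartialOrder D] [StarOrderedRing D]

/-- Parallelogram law: the difference of the two sides is (y - cx)*(y - cx). -/
theorem star_add_mul_add_le (x y : D) (c : ℂ) (hc : star c * c = 1) :
    star (y + c • x) * (y + c • x) ≤ 2 • (star x * x + star y * y) := by
  rw [← sub_nonneg]
  convert star_mul_self_nonneg (y - c • x) using 1
  have hc' : c * star c = 1 := by rw [mul_comm, hc]
  simp only [star_add, star_sub, star_smul, add_mul, mul_add, sub_mul, mul_sub, smul_mul_assoc,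
    mul_smul_comm, smul_add, smul_sub, smul_smul, hc', one_smul, two_smul]
  abel

/-- Polarization writes four times the sum through (y + cx)*(y + cx) with c = ±1, ±i, and each of
these four sums has norm at most 2K. The number of terms does not enter, which is all that matters
later. -/
theorem norm_sum_star_mul_le {ι : Type*} (s : Finset ι) (x y : ι → D) :
    ‖∑ i ∈ s, star (x i) * y i‖ ≤
      2 * (‖∑ i ∈ s, star (x i) * x i‖ + ‖∑ i ∈ s, star (y i) * y i‖) := by
  set K := ‖∑ i ∈ s, star (x i) * x i‖ + ‖∑ i ∈ s, star (y i) * y i‖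
  have h (c : ℂ) (hc : star c * c = 1) :
      ‖∑ i ∈ s, star (y i + c • x i) * (y i + c • x i)‖ ≤ 2 * K := by
    refine (CStarAlgebra.norm_le_norm_of_nonneg_of_le
      (Finset.sum_nonneg fun i _ => star_mul_self_nonneg _)
      (Finset.sum_le_sum fun i _ => star_add_mul_add_le (x i) (y i) c hc)).trans ?_
    rw [← Finset.smul_sum, Finset.sum_add_distrib, two_smul, two_mul]
    exact (norm_add_le _ _).trans (add_le_add (norm_add_le _ _) (norm_add_le _ _))
  have key : (4 : ℂ) • ∑ i ∈ s, star (x i) * y i =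
      (∑ i ∈ s, star (y i + (1 : ℂ) • x i) * (y i + (1 : ℂ) • x i)
        - ∑ i ∈ s, star (y i + (-1 : ℂ) • x i) * (y i + (-1 : ℂ) • x i))
      + Complex.I • (∑ i ∈ s, star (y i + Complex.I • x i) * (y i + Complex.I • x i)
        - ∑ i ∈ s, star (y i + (-Complex.I) • x i) * (y i + (-Complex.I) • x i)) := by
    simp only [Finset.smul_sum, ← Finset.sum_sub_distrib, ← Finset.sum_add_distrib]
    refine Finset.sum_congr rfl fun i _ => ?_
    simp only [star_add, star_smul, add_mul, mul_add, smul_mul_assoc, mul_smul_comm, smul_smul,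
      smul_sub, smul_add, star_one, star_neg, Complex.star_def, Complex.conj_I]
    match_scalars <;> simp
    norm_num
  have h4 : 4 * ‖∑ i ∈ s, star (x i) * y i‖ ≤ 8 * K := by
    calc 4 * ‖∑ i ∈ s, star (x i) * y i‖ = ‖(4 : ℂ) • ∑ i ∈ s, star (x i) * y i‖ := by
          rw [norm_smul]; norm_num
      _ ≤ _ := by
        rw [key]
        refine (norm_add_le _ _).trans (add_le_add (norm_sub_le _ _) ?_)
        rw [norm_smul, Complex.norm_I, one_mul]
        exact norm_sub_le _ _
      _ ≤ (2 * K + 2 * K) + (2 * K + 2 * K) :=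
        add_le_add (add_le_add (h _ (by simp)) (h _ (by simp)))
          (add_le_add (h _ (by simp)) (h _ (by simp)))
      _ = 8 * K := by ring
  linarith

theorem mul_self_le_norm_smul {a : D} (ha : 0 ≤ a) {K : ℝ} (hK : ‖a‖ ≤ K) : a * a ≤ K • a := by
  have hs : IsSelfAdjoint a := .of_nonneg ha
  have h1 : 0 ≤ algebraMap ℝ D K - a := sub_nonneg.2 <|
    hs.le_algebraMap_norm_self.trans (algebraMap_mono D hK)
  have h2 := Commute.mul_nonneg h1 ha
    ((Algebra.commute_algebraMap_left K a).sub_left (Commute.refl a))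
  rwa [sub_mul, sub_nonneg, ← Algebra.smul_def] at h2

/-- Each a_i lies below the whole sum, so ‖a_i‖ ≤ K and a_i² ≤ K a_i; summing gives K². -/
theorem norm_sum_mul_self_le {ι : Type*} (s : Finset ι) (a : ι → D) (ha : ∀ i ∈ s, 0 ≤ a i) :
    ‖∑ i ∈ s, a i * a i‖ ≤ ‖∑ i ∈ s, a i‖ ^ 2 := by
  set K := ‖∑ i ∈ s, a i‖
  have h1 : ∀ i ∈ s, a i * a i ≤ K • a i := fun i hi => mul_self_le_norm_smul (ha i hi)
    (CStarAlgebra.norm_le_norm_of_nonneg_of_le (ha i hi) (Finset.single_le_sum ha hi))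
  refine (CStarAlgebra.norm_le_norm_of_nonneg_of_le (Finset.sum_nonneg fun i hi => ?_)
    (Finset.sum_le_sum h1)).trans ?_
  · exact Commute.mul_nonneg (ha i hi) (ha i hi) rfl
  · rw [← Finset.smul_sum, norm_smul, norm_norm, sq]

theorem norm_sum_mul_le {ι : Type*} (s : Finset ι) (a b : ι → D) (ha : ∀ i ∈ s, 0 ≤ a i)
    (hb : ∀ i ∈ s, 0 ≤ b i) :
    ‖∑ i ∈ s, a i * b i‖ ≤ 2 * (‖∑ i ∈ s, a i‖ ^ 2 + ‖∑ i ∈ s, b i‖ ^ 2) := by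
  have hsa : ∀ i ∈ s, star (a i) = a i := fun i hi => (IsSelfAdjoint.of_nonneg (ha i hi)).star_eq
  have hsb : ∀ i ∈ s, star (b i) = b i := fun i hi => (IsSelfAdjoint.of_nonneg (hb i hi)).star_eq
  have h := norm_sum_star_mul_le s a b
  rw [Finset.sum_congr rfl fun i hi => by rw [hsa i hi],
    Finset.sum_congr rfl fun i hi => congrArg (· * a i) (hsa i hi),
    Finset.sum_congr rfl fun i hi => congrArg (· * b i) (hsb i hi)] at h
  have := norm_sum_mul_self_le s a ha
  have := norm_sum_mul_self_le s b hb
  linarith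

end CauchySchwarz

/-! ### Tridiagonal double sums. -/

section Tridiagonal

/-- The weight i - j kills the diagonal and equals ±1 on its two neighbours; all other products
vanish. -/
theorem sum_sub_mul_of_tridiagonal {D : Type*} [Ring D] [Algebra ℂ D] (a b : ℕ → D)
    (hab : ∀ i j, i + 2 ≤ j ∨ j + 2 ≤ i → a i * b j = 0) (N : ℕ) :
    ∑ i ∈ Finset.range (N + 1), ∑ j ∈ Finset.range (N + 1), ((i : ℂ) - j) • (a i * b j) =
      ∑ i ∈ Finset.range N, a (i + 1) * b i - ∑ i ∈ Finset.range N, a i * b (i + 1) := by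
  induction N with
  | zero => simp
  | succ N ih =>
    have hrow : ∑ j ∈ Finset.range N, ((↑(N + 1) : ℂ) - j) • (a (N + 1) * b j) = 0 :=
      Finset.sum_eq_zero fun i hi => by
        rw [Finset.mem_range] at hi
        rw [hab (N + 1) i (by omega), smul_zero]
    have hcol : ∑ i ∈ Finset.range N, ((i : ℂ) - ↑(N + 1)) • (a i * b (N + 1)) = 0 :=
      Finset.sum_eq_zero fun i hi => by
        rw [Finset.mem_range] at hi
        rw [hab i (N + 1) (by omega), smul_zero]
    rw [Finset.sum_range_succ, Finset.sum_congr rfl fun i _ => Finset.sum_range_succ _ (N + 1),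
      Finset.sum_add_distrib, ih, Finset.sum_range_succ _ (N + 1), Finset.sum_range_succ _ N, hcol,
      Finset.sum_range_succ (fun j => ((↑(N + 1) : ℂ) - j) • (a (N + 1) * b j)) N, hrow,
      Finset.sum_range_succ _ N, Finset.sum_range_succ _ N]
    push_cast
    simp only [sub_self, zero_smul, add_zero, zero_add, add_sub_cancel_left, one_smul,
      sub_add_cancel_left, neg_smul]
    abel

variable {D : Type*} [CStarAlgebra D] [PartialOrder D] [StarOrderedRing D]

/-- The bound sees only the total sums of a and b, although the weights i - j grow with N. -/
theorem norm_sum_sub_mul_le (a b : ℕ → D) (ha : ∀ i, 0 ≤ a i) (hb : ∀ i, 0 ≤ b i)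
    (hab : ∀ i j, i + 2 ≤ j ∨ j + 2 ≤ i → a i * b j = 0) (N : ℕ) :
    ‖∑ i ∈ Finset.range (N + 1), ∑ j ∈ Finset.range (N + 1), ((i : ℂ) - j) • (a i * b j)‖ ≤
      4 * (‖∑ i ∈ Finset.range (N + 1), a i‖ ^ 2 + ‖∑ i ∈ Finset.range (N + 1), b i‖ ^ 2) := by
  have h0 (c : ℕ → D) (hc : ∀ i, 0 ≤ c i) :
      ‖∑ i ∈ Finset.range N, c i‖ ≤ ‖∑ i ∈ Finset.range (N + 1), c i‖ :=
    CStarAlgebra.norm_le_norm_of_nonneg_of_le (Finset.sum_nonneg fun i _ => hc i)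
      (by rw [Finset.sum_range_succ]; exact le_add_of_nonneg_right (hc _))
  have h1 (c : ℕ → D) (hc : ∀ i, 0 ≤ c i) :
      ‖∑ i ∈ Finset.range N, c (i + 1)‖ ≤ ‖∑ i ∈ Finset.range (N + 1), c i‖ :=
    CStarAlgebra.norm_le_norm_of_nonneg_of_le (Finset.sum_nonneg fun i _ => hc _)
      (by rw [Finset.sum_range_succ']; exact le_add_of_nonneg_right (hc _))
  rw [sum_sub_mul_of_tridiagonal a b hab]
  refine (norm_sub_le _ _).trans ?_
  have h2 := norm_sum_mul_le (Finset.range N) (fun i => a (i + 1)) b (fun i _ => ha _)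
    (fun i _ => hb _)
  have h3 := norm_sum_mul_le (Finset.range N) a (fun i => b (i + 1)) (fun i _ => ha _)
    (fun i _ => hb _)
  have := pow_le_pow_left₀ (norm_nonneg _) (h0 a ha) 2
  have := pow_le_pow_left₀ (norm_nonneg _) (h0 b hb) 2
  have := pow_le_pow_left₀ (norm_nonneg _) (h1 a ha) 2
  have := pow_le_pow_left₀ (norm_nonneg _) (h1 b hb) 2
  linarith

end Tridiagonal

/-! ### Hat functions: a partition of unity on [0, N] that reproduces t. -/

section Hat

/-- The hat function of width one centred at `i`. -/
def hat (i : ℕ) (t : ℝ) : ℝ := max 0 (1 - |t - i|)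

theorem continuous_hat (i : ℕ) : Continuous (hat i) := by unfold hat; fun_prop

theorem hat_nonneg (i : ℕ) (t : ℝ) : 0 ≤ hat i t := le_max_left _ _

theorem hat_mul_hat {i j : ℕ} (h : i + 2 ≤ j ∨ j + 2 ≤ i) (t : ℝ) : hat i t * hat j t = 0 := by
  by_contra hne
  obtain ⟨hi, hj⟩ := mul_ne_zero_iff.1 hne
  have aux (k : ℕ) (hk : hat k t ≠ 0) : |t - k| < 1 := by
    by_contra hc
    exact hk (max_eq_left (by linarith))
  have hi := abs_lt.1 (aux i hi)
  have hj := abs_lt.1 (aux j hj)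
  rcases h with h | h
  · have : (i : ℝ) + 2 ≤ j := by exact_mod_cast h
    linarith
  · have : (j : ℝ) + 2 ≤ i := by exact_mod_cast h
    linarith

/-- Closed forms for every t ≥ 0, also beyond N: the induction step on [N, N + 2] needs the previous
partial sum where it has already decayed. -/
theorem hat_sum_aux (N : ℕ) {t : ℝ} (ht : 0 ≤ t) :
    ∑ i ∈ Finset.range (N + 1), hat i t = min 1 (max 0 (N + 1 - t)) ∧
    ∑ i ∈ Finset.range (N + 1), i * hat i t = min t (N * max 0 (N + 1 - t)) := by
  induction N with
  | zero =>
    simp only [zero_add, Finset.sum_range_one, hat, Nat.cast_zero, sub_zero, abs_of_nonneg ht,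
      zero_mul]
    exact ⟨(min_eq_right (max_le zero_le_one (by linarith))).symm, (min_eq_right ht).symm⟩
  | succ N ih =>
    rw [Finset.sum_range_succ, ih.1, Finset.sum_range_succ _ (N + 1), ih.2]
    push_cast
    simp only [hat]
    push_cast
    have hN : (0 : ℝ) ≤ N := Nat.cast_nonneg N
    rcases le_total t N with h1 | h1
    · rw [max_eq_right (by linarith : (0 : ℝ) ≤ N + 1 - t), min_eq_left (by linarith),
        abs_of_nonpos (by linarith), max_eq_left (by linarith),
        max_eq_right (by linarith : (0 : ℝ) ≤ N + 1 + 1 - t), min_eq_left (by linarith),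
        min_eq_left (by nlinarith), min_eq_left (by nlinarith)]
      constructor <;> ring
    rcases le_total t (N + 1) with h2 | h2
    · rw [max_eq_right (by linarith : (0 : ℝ) ≤ N + 1 - t), min_eq_right (by linarith),
        abs_of_nonpos (by linarith), max_eq_right (by linarith),
        max_eq_right (by linarith : (0 : ℝ) ≤ N + 1 + 1 - t), min_eq_left (by linarith),
        min_eq_right (by nlinarith), min_eq_left (by nlinarith)]
      constructor <;> ring
    rw [max_eq_left (by linarith : (N : ℝ) + 1 - t ≤ 0), min_eq_right (by linarith),
      abs_of_nonneg (by linarith), mul_zero, min_eq_right ht]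
    rcases le_total t (N + 1 + 1) with h3 | h3
    · rw [max_eq_right (by linarith), max_eq_right (by linarith), min_eq_right (by linarith),
        min_eq_right (by nlinarith)]
      constructor <;> ring
    · rw [max_eq_left (by linarith), max_eq_left (by linarith), min_eq_right (by linarith),
        min_eq_right (by nlinarith)]
      constructor <;> ring

theorem sum_hat {N : ℕ} {t : ℝ} (ht : 0 ≤ t) (htN : t ≤ N) :
    ∑ i ∈ Finset.range (N + 1), hat i t = 1 := by
  rw [(hat_sum_aux N ht).1, max_eq_right (by linarith), min_eq_left (by linarith)]

theorem sum_mul_hat {N : ℕ} {t : ℝ} (ht : 0 ≤ t) (htN : t ≤ N) :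
    ∑ i ∈ Finset.range (N + 1), i * hat i t = t := by
  rw [(hat_sum_aux N ht).2, max_eq_right (by linarith), min_eq_left (by nlinarith)]

end Hat

/-! ### The multiplicativity identity for orthogonality-preserving positive maps. -/

section Orthogonality

variable {B D : Type*} [CStarAlgebra B] [PartialOrder B] [StarOrderedRing B]
  [CStarAlgebra D] [PartialOrder D] [StarOrderedRing D]

/-- With 1 = Σ p_i and y = Σ i p_i, the defect is Σ (i - j) T(p_i)T(p_j z), and T(p_i)T(p_j z) = 0
once |i - j| ≥ 2. The slices sum to T(1) and T(z), so y drops out of the bound. -/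
theorem norm_map_mul_map_sub_le (T : B →ₗ[ℂ] D) (hT : ∀ a, 0 ≤ a → 0 ≤ T a)
    (hT' : ∀ a b, 0 ≤ a → 0 ≤ b → a * b = 0 → b * a = 0 → T a * T b = 0)
    {y z : B} (hy : 0 ≤ y) (hz : 0 ≤ z) (hyz : Commute y z) :
    ‖T y * T z - T 1 * T (y * z)‖ ≤ 4 * (‖T 1‖ ^ 2 + ‖T z‖ ^ 2) := by
  have hsa : IsSelfAdjoint y := .of_nonneg hy
  obtain ⟨N, hN⟩ := exists_nat_ge ‖y‖
  have hspec (t : ℝ) (ht : t ∈ spectrum ℝ y) : 0 ≤ t ∧ t ≤ N := by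
    refine ⟨spectrum_nonneg_of_nonneg hy ht, ?_⟩
    rcases subsingleton_or_nontrivial B with hB | hB
    · simp [spectrum.of_subsingleton] at ht
    · exact ((Real.le_norm_self t).trans (spectrum.norm_le_norm_of_mem ht)).trans hN
  let p : ℕ → B := fun i => cfc (hat i) y
  have hcont (i : ℕ) : ContinuousOn (hat i) (spectrum ℝ y) := (continuous_hat i).continuousOn
  have hp (i : ℕ) : 0 ≤ p i := cfc_nonneg fun t _ => hat_nonneg i t
  have hpc (i : ℕ) (w : B) (hw : Commute y w) : Commute (p i) w := hw.cfc_real _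
  have hpp (i j : ℕ) (h : i + 2 ≤ j ∨ j + 2 ≤ i) : p i * p j = 0 := by
    rw [← cfc_mul _ _ y (hcont i) (hcont j), cfc_congr (g := fun _ => 0) fun t _ => hat_mul_hat h t]
    exact cfc_const_zero ℝ y
  have h1 : ∑ i ∈ Finset.range (N + 1), p i = 1 := by
    rw [← cfc_sum _ _ _ fun i _ => hcont i, ← cfc_const_one ℝ y]
    refine cfc_congr fun t ht => ?_
    simpa using sum_hat (hspec t ht).1 (hspec t ht).2
  have hy' : ∑ i ∈ Finset.range (N + 1), (i : ℂ) • p i = y := by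
    have : ∀ i ∈ Finset.range (N + 1), (i : ℂ) • p i = cfc (fun t => (i : ℝ) * hat i t) y := by
      intro i _
      rw [cfc_const_mul _ _ y (hcont i)]
      simp [p, Nat.cast_smul_eq_nsmul]
    rw [Finset.sum_congr rfl this, ← cfc_sum _ _ _ fun i _ => by
      exact continuousOn_const.mul (hcont i)]
    conv_rhs => rw [← cfc_id ℝ y]
    refine cfc_congr fun t ht => ?_
    simpa using sum_mul_hat (hspec t ht).1 (hspec t ht).2
  have hpz (i : ℕ) : 0 ≤ p i * z := Commute.mul_nonneg (hp i) hz (hpc i z hyz)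
  have hab (i j : ℕ) (h : i + 2 ≤ j ∨ j + 2 ≤ i) : T (p i) * T (p j * z) = 0 := by
    refine hT' _ _ (hp i) (hpz j) ?_ ?_
    · rw [← mul_assoc, hpp i j h, zero_mul]
    · rw [mul_assoc, ← (hpc i z hyz).eq, ← mul_assoc, hpp j i h.symm, zero_mul]
  have hsum1 : ∑ i ∈ Finset.range (N + 1), T (p i) = T 1 := by rw [← map_sum, h1]
  have hsumz : ∑ i ∈ Finset.range (N + 1), T (p i * z) = T z := by
    rw [← map_sum, ← Finset.sum_mul, h1, one_mul]
  have key := norm_sum_sub_mul_le (fun i => T (p i)) (fun i => T (p i * z))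
    (fun i => hT _ (hp i)) (fun i => hT _ (hpz i)) hab N
  rw [hsum1, hsumz] at key
  refine le_trans (le_of_eq (congrArg norm ?_)) key
  simp only [sub_smul, Finset.sum_sub_distrib]
  congr 1
  · conv_lhs => rw [← hy']
    rw [map_sum, ← hsumz, Finset.sum_mul_sum]
    simp only [map_smul, smul_mul_assoc]
  · conv_lhs => rw [← hy']
    rw [← hsum1, Finset.sum_mul (f := fun i : ℕ => (i : ℂ) • p i), map_sum, Finset.sum_mul_sum]
    simp only [map_smul, smul_mul_assoc, mul_smul_comm]

/-- A positive linear map preserving orthogonality of positive elements satisfies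
`T y * T z = T 1 * T (y * z)` on commuting positive elements. -/
theorem map_mul_map_of_commute (T : B →ₗ[ℂ] D) (hT : ∀ a, 0 ≤ a → 0 ≤ T a)
    (hT' : ∀ a b, 0 ≤ a → 0 ≤ b → a * b = 0 → b * a = 0 → T a * T b = 0)
    {y z : B} (hy : 0 ≤ y) (hz : 0 ≤ z) (hyz : Commute y z) :
    T y * T z = T 1 * T (y * z) := by
  rw [← sub_eq_zero, ← norm_eq_zero]
  by_contra hne
  have hpos := lt_of_le_of_ne (norm_nonneg _) (Ne.symm hne)
  -- For this n the defect of n • y, which is n times that of y, would exceed the bound that does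
  -- not depend on y.
  obtain ⟨n, hn⟩ := exists_nat_gt
    (4 * (‖T 1‖ ^ 2 + ‖T z‖ ^ 2) / ‖T y * T z - T 1 * T (y * z)‖)
  rw [div_lt_iff₀ hpos] at hn
  have h := norm_map_mul_map_sub_le T hT hT' (nsmul_nonneg hy n) hz (hyz.smul_left n)
  rw [smul_mul_assoc, map_nsmul, map_nsmul, smul_mul_assoc, mul_smul_comm, ← smul_sub,
    ← Nat.cast_smul_eq_nsmul ℝ n, norm_smul, Real.norm_natCast] at h
  linarith

end Orthogonality

/-! ### Positive maps: domination by T(1), and the identity on commuting subalgebras. -/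

section Positivity

attribute [local instance] CStarAlgebra.spectralOrder CStarAlgebra.spectralOrderedRing

variable {A B : Type*} [CStarAlgebra A] [CStarAlgebra B]

theorem isPos_star_mul_self (a : A) : IsPos (star a * a) := star_mul_self_nonneg a

theorem IsPos.star_eq {a : A} (ha : IsPos a) : star a = a := (IsSelfAdjoint.of_nonneg ha).star_eq

theorem IsPos.map {a : A} (ha : IsPos a) (φ : A →⋆ₐ[ℂ] B) : IsPos (φ a) := by
  change 0 ≤ a at ha
  exact map_nonneg φ ha

/-- Injective *-homomorphisms reflect positivity. -/
theorem IsPos.of_map (φ : A →⋆ₐ[ℂ] B) (hφ : Function.Injective φ) {a : A} (ha : IsPos (φ a)) :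
    IsPos a := by
  have hsa : IsSelfAdjoint a := hφ (by rw [map_star, ha.star_eq])
  change 0 ≤ φ a at ha
  change 0 ≤ a
  rw [StarOrderedRing.nonneg_iff_spectrum_nonneg (R := ℝ) _ hsa,
    ← hsa.map_spectrum_real φ hφ]
  exact fun t ht => spectrum_nonneg_of_nonneg ha ht

theorem IsPos.norm_le_one {a : A} (ha : IsPos a) (ha' : IsPos (1 - a)) : ‖a‖ ≤ 1 :=
  (CStarAlgebra.norm_le_one_iff_of_nonneg a ha).2 (sub_nonneg.1 ha')

theorem span_isPos : Submodule.span ℂ {a : A | IsPos a} = ⊤ := CStarAlgebra.span_nonneg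

theorem exists_bound_of_isPos (T : A →ₗ[ℂ] B) (hT : ∀ a, IsPos a → IsPos (T a)) :
    ∃ C : ℝ, 0 ≤ C ∧ ∀ a, ‖T a‖ ≤ C * ‖a‖ := by
  obtain ⟨C, hC⟩ := PositiveLinearMap.exists_norm_apply_le (PositiveLinearMap.mk₀ T hT)
  exact ⟨C, C.2, hC⟩

theorem map_le_norm_smul_map_one (T : A →ₗ[ℂ] B) (hT : ∀ a, IsPos a → IsPos (T a)) {a : A}
    (ha : IsPos a) : T a ≤ ‖a‖ • T 1 := by
  have h := hT (algebraMap ℝ A ‖a‖ - a)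
    (sub_nonneg.2 (IsSelfAdjoint.le_algebraMap_norm_self (.of_nonneg ha)))
  have h' : T (algebraMap ℝ A ‖a‖ - a) = ‖a‖ • T 1 - T a := by
    rw [map_sub, Algebra.algebraMap_eq_smul_one, ← Complex.coe_smul, map_smul, Complex.coe_smul]
  rw [h'] at h
  exact sub_nonneg.1 h

theorem norm_map_le_of_isPos (T : A →ₗ[ℂ] B) (hT : ∀ a, IsPos a → IsPos (T a)) {a : A}
    (ha : IsPos a) : ‖T a‖ ≤ ‖a‖ * ‖T 1‖ := by
  have h1 := map_le_norm_smul_map_one T hT ha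
  refine (CStarAlgebra.norm_le_norm_of_nonneg_of_le (hT a ha) h1).trans ?_
  rw [norm_smul, norm_norm]

theorem map_star_of_isPos (T : A →ₗ[ℂ] B) (hT : ∀ a, IsPos a → IsPos (T a)) (a : A) :
    T (star a) = star (T a) := by
  have h : a ∈ Submodule.span ℂ {a : A | IsPos a} := by rw [span_isPos]; trivial
  induction h using Submodule.span_induction with
  | zero => simp
  | add x y _ _ hx hy => rw [star_add, map_add, map_add, star_add, hx, hy]
  | smul c x _ hx => rw [star_smul, map_smul, map_smul, star_smul, hx]
  | mem a ha => rw [IsPos.star_eq ha, (hT a ha).star_eq]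

/-- If `T` is positive and `T 1 * z = 0` then `T a * z = 0` for all `a`. -/
theorem map_mul_eq_zero_of_map_one_mul (T : A →ₗ[ℂ] B) (hT : ∀ a, IsPos a → IsPos (T a)) {z : B}
    (hz : T 1 * z = 0) (a : A) : T a * z = 0 := by
  have h : a ∈ Submodule.span ℂ {a : A | IsPos a} := by rw [span_isPos]; trivial
  induction h using Submodule.span_induction with
  | zero => simp
  | add x y _ _ hx hy => rw [map_add, add_mul, hx, hy, add_zero]
  | smul c x _ hx => rw [map_smul, smul_mul_assoc, hx, smul_zero]
  | mem a ha =>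
    have h1 := map_le_norm_smul_map_one T hT ha
    have hTa : 0 ≤ T a := hT a ha
    set b := CFC.sqrt (T a)
    have hb : b * b = T a := CFC.sqrt_mul_sqrt_self (T a) hTa
    have hbs : star b = b := (IsSelfAdjoint.of_nonneg (CFC.sqrt_nonneg (T a))).star_eq
    -- T(a) ≤ ‖a‖T(1) compresses to z*T(a)z ≤ 0, so √T(a) z = 0.
    have h2 : star z * T a * z ≤ 0 := by
      refine (star_left_conjugate_le_conjugate h1 z).trans_eq ?_
      rw [mul_assoc, smul_mul_assoc, hz, smul_zero, mul_zero]
    have h3 : star (b * z) * (b * z) = 0 := by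
      rw [star_mul, hbs, mul_assoc, ← mul_assoc b b z, hb, ← mul_assoc]
      exact le_antisymm h2 (star_left_conjugate_nonneg hTa z)
    rw [CStarRing.star_mul_self_eq_zero_iff] at h3
    rw [← hb, mul_assoc, h3, mul_zero]

theorem map_mul_map_of_isPos_of_commute (T : A →ₗ[ℂ] B) (hT : ∀ a, IsPos a → IsPos (T a))
    (hT' : ∀ a b, IsPos a → IsPos b → a * b = 0 → b * a = 0 → T a * T b = 0)
    {y z : A} (hy : IsPos y) (hz : IsPos z) (hyz : Commute y z) :
    T y * T z = T 1 * T (y * z) :=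
  map_mul_map_of_commute T hT hT' hy hz hyz

/-- The identity with z = 1, extended linearly from positive elements. -/
theorem commute_map_map_one (T : A →ₗ[ℂ] B) (hT : ∀ a, IsPos a → IsPos (T a))
    (hT' : ∀ a b, IsPos a → IsPos b → a * b = 0 → b * a = 0 → T a * T b = 0) (a : A) :
    Commute (T a) (T 1) := by
  have h : a ∈ Submodule.span ℂ {a : A | IsPos a} := by rw [span_isPos]; trivial
  induction h using Submodule.span_induction with
  | zero => rw [map_zero]; exact Commute.zero_left _
  | add x y _ _ hx hy => rw [map_add]; exact hx.add_left hy
  | smul c x _ hx => rw [map_smul]; exact hx.smul_left c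
  | mem a ha =>
    have h1 : IsPos (1 : A) := zero_le_one
    rw [Commute, SemiconjBy, map_mul_map_of_isPos_of_commute T hT hT' ha h1 (Commute.one_right a),
      mul_one]

/-- Both sides are bilinear in p and q. Decomposing inside P and Q, rather than inside A, keeps all
the positive pieces commuting. -/
theorem map_mul_map_of_forall_commute (T : A →ₗ[ℂ] B) (hT : ∀ a, IsPos a → IsPos (T a))
    (hT' : ∀ a b, IsPos a → IsPos b → a * b = 0 → b * a = 0 → T a * T b = 0)
    {P Q : Type*} [CStarAlgebra P] [CStarAlgebra Q] (i : P →⋆ₐ[ℂ] A) (j : Q →⋆ₐ[ℂ] A)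
    (hij : ∀ p q, Commute (i p) (j q)) (p : P) (q : Q) :
    T (i p) * T (j q) = T 1 * T (i p * j q) := by
  have hp : p ∈ Submodule.span ℂ {a : P | IsPos a} := by rw [span_isPos]; trivial
  have hq : q ∈ Submodule.span ℂ {a : Q | IsPos a} := by rw [span_isPos]; trivial
  induction hp using Submodule.span_induction with
  | zero => simp
  | add x y _ _ hx hy => simp only [map_add, add_mul, mul_add, hx, hy]
  | smul c x _ hx => simp only [map_smul, smul_mul_assoc, mul_smul_comm, hx]
  | mem p hp =>
    induction hq using Submodule.span_induction with
    | zero => simp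
    | add x y _ _ hx hy => simp only [map_add, mul_add, hx, hy]
    | smul c x _ hx => simp only [map_smul, mul_smul_comm, hx]
    | mem q hq => exact map_mul_map_of_isPos_of_commute T hT hT' (hp.map i) (hq.map j) (hij p q)

/-- Cauchy–Schwarz applied to √c_i and √c_i ι(a_i): when ‖a_i‖ ≤ 1, commutation gives √c_i
ι(a_i*a_i) √c_i ≤ c_i, so both square sums are at most ‖Σ c_i‖. -/
theorem norm_sum_mul_map_le (ι : A →⋆ₐ[ℂ] B) {κ : Type*} (s : Finset κ) (c : κ → B) (a : κ → A)
    (hc : ∀ i, IsPos (c i)) (hca : ∀ i a, Commute (c i) (ι a)) {r : ℝ} (hr : 0 ≤ r)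
    (ha : ∀ i, ‖a i‖ ≤ r) : ‖∑ i ∈ s, c i * ι (a i)‖ ≤ 4 * ‖∑ i ∈ s, c i‖ * r := by
  have key (a : κ → A) (ha : ∀ i, ‖a i‖ ≤ 1) :
      ‖∑ i ∈ s, c i * ι (a i)‖ ≤ 4 * ‖∑ i ∈ s, c i‖ := by
    let b i := CFC.sqrt (c i)
    have hb i : b i * b i = c i := CFC.sqrt_mul_sqrt_self (c i) (hc i)
    have hbs i : star (b i) = b i := (IsSelfAdjoint.of_nonneg (CFC.sqrt_nonneg (c i))).star_eq
    have h := norm_sum_star_mul_le s b fun i => b i * ι (a i)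
    simp only [hbs, ← mul_assoc, hb] at h
    refine h.trans ?_
    have h2 : ‖∑ i ∈ s, star (b i * ι (a i)) * b i * ι (a i)‖ ≤ ‖∑ i ∈ s, c i‖ := by
      refine CStarAlgebra.norm_le_norm_of_nonneg_of_le (Finset.sum_nonneg fun i _ => ?_)
        (Finset.sum_le_sum fun i _ => ?_)
      · rw [mul_assoc]; exact star_mul_self_nonneg _
      · have h3 : star (ι (a i)) * ι (a i) ≤ 1 := by
          have : star (ι (a i)) * ι (a i) ≤ algebraMap ℝ B (‖ι (a i)‖ ^ 2) :=
            CStarAlgebra.star_mul_le_algebraMap_norm_sq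
          refine this.trans ?_
          rw [← map_one (algebraMap ℝ B)]
          refine algebraMap_mono B (pow_le_one₀ (norm_nonneg _) ?_)
          exact (NonUnitalStarAlgHom.norm_apply_le ι (a i)).trans (ha i)
        have hcb (x : A) : Commute (b i) (ι x) := by
          have := (hca i x)
          change Commute (cfcₙ _ (c i)) _
          exact this.cfcₙ_nnreal _
        have h4 : star (b i * ι (a i)) * b i * ι (a i) =
            star (b i) * (star (ι (a i)) * ι (a i)) * b i := by
          have hcc : Commute (b i) (star (ι (a i)) * ι (a i)) := by
            rw [← map_star, ← map_mul]; exact hcb _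
          rw [star_mul, hbs, hcc.eq]
          simp only [mul_assoc]
          rw [(hcb _).eq, ← mul_assoc (b i), (hcb _).eq, mul_assoc]
        rw [h4]
        refine (star_left_conjugate_le_conjugate h3 (b i)).trans_eq ?_
        rw [mul_one, hbs, hb]
    linarith
  -- The Cauchy–Schwarz bound is additive and not homogeneous in a, so the case of general r comes
  -- from rescaling by r⁻¹.
  rcases hr.eq_or_lt with rfl | hr
  · have : ∀ i, a i = 0 := fun i => norm_le_zero_iff.1 (ha i)
    simp [this]
  · have h := key (fun i => ((r⁻¹ : ℝ) : ℂ) • a i) fun i => by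
      rw [norm_smul, Complex.norm_real, norm_inv, Real.norm_of_nonneg hr.le, inv_mul_le_iff₀ hr]
      simpa using ha i
    simp only [map_smul, mul_smul_comm, ← Finset.smul_sum] at h
    rwa [norm_smul, Complex.norm_real, norm_inv, Real.norm_of_nonneg hr.le, inv_mul_le_iff₀ hr,
      mul_comm] at h

end Positivity

/-! ### Positivity of matrices and complete positivity. -/

section Matrix

attribute [local instance] CStarAlgebra.spectralOrder CStarAlgebra.spectralOrderedRing

variable {A B : Type*} [CStarAlgebra A] [CStarAlgebra B] {k : ℕ}

/-- Positivity in the matrix algebra `M_k(A)`. -/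
def IsMatPos (M : CStarMatrix (Fin k) (Fin k) A) : Prop := 0 ≤ M

theorem OrderZeroMap.isMatPos_map (φ : OrderZeroMap A B) {M : CStarMatrix (Fin k) (Fin k) A}
    (hM : IsMatPos M) : IsMatPos (M.map φ) := φ.map_cstarMatrix_nonneg' k M hM

theorem OrderZeroMap.isPos_map (φ : OrderZeroMap A B) {a : A} (ha : IsPos a) : IsPos (φ a) :=
  map_nonneg φ.toCompletelyPositiveMap (show 0 ≤ a from ha)

/-- The linear map underlying an order zero map. -/
def OrderZeroMap.asLinearMap (φ : OrderZeroMap A B) : A →ₗ[ℂ] B := φ.toLinearMap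

/-- A linear map which is positive on matrices and preserves orthogonality is order zero. -/
def OrderZeroMap.ofLinearMap (T : A →ₗ[ℂ] B)
    (hT : ∀ (k : ℕ) (M : CStarMatrix (Fin k) (Fin k) A), IsMatPos M → IsMatPos (M.map T))
    (hT' : ∀ a b : A, IsPos a → IsPos b → a * b = 0 → b * a = 0 → T a * T b = 0) :
    OrderZeroMap A B where
  toLinearMap := T
  map_cstarMatrix_nonneg' := hT
  map_orthogonal' a b ha hb hab hba := ⟨hT' a b ha hb hab hba, hT' b a hb ha hba hab⟩

theorem IsMatPos.map {M : CStarMatrix (Fin k) (Fin k) A} (hM : IsMatPos M) (φ : A →⋆ₐ[ℂ] B) :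
    IsMatPos (M.map φ) :=
  CompletelyPositiveMapClass.map_cstarMatrix_nonneg' φ k M hM

/-- Injective *-homomorphisms reflect positivity of matrices. -/
theorem IsMatPos.of_map (φ : A →⋆ₐ[ℂ] B) (hφ : Function.Injective φ)
    {M : CStarMatrix (Fin k) (Fin k) A} (hM : IsMatPos (M.map φ)) : IsMatPos M := by
  let Φ : CStarMatrix (Fin k) (Fin k) A →⋆ₐ[ℂ] CStarMatrix (Fin k) (Fin k) B :=
    { CStarMatrix.mapₙₐ (n := Fin k) (φ : A →⋆ₙₐ[ℂ] B) with
      map_one' := by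
        ext i j
        rcases eq_or_ne i j with rfl | h
        · simp [CStarMatrix.mapₙₐ, CStarMatrix.mapₗ]
        · simp [CStarMatrix.mapₙₐ, CStarMatrix.mapₗ, h]
      commutes' := fun c => by
        ext i j
        rcases eq_or_ne i j with rfl | h
        · simpa [CStarMatrix.mapₙₐ, CStarMatrix.mapₗ, CStarMatrix.algebraMap_apply] using
            AlgHomClass.commutes φ c
        · simp [CStarMatrix.mapₙₐ, CStarMatrix.mapₗ, CStarMatrix.algebraMap_apply, h] }
  exact IsPos.of_map Φ (CStarMatrix.map_injective hφ) hM

theorem sum_cstarMatrix_apply {κ : Type*} (s : Finset κ) (M : κ → CStarMatrix (Fin k) (Fin k) A)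
    (i j : Fin k) : (∑ c ∈ s, M c) i j = ∑ c ∈ s, M c i j :=
  Matrix.sum_apply i j s fun c => CStarMatrix.ofMatrix.symm (M c)

theorem IsMatPos.sum {κ : Type*} (s : Finset κ) (M : κ → CStarMatrix (Fin k) (Fin k) A)
    (hM : ∀ i ∈ s, IsMatPos (M i)) : IsMatPos (∑ i ∈ s, M i) := Finset.sum_nonneg hM

theorem IsMatPos.of_tendsto (M : CStarMatrix (Fin k) (Fin k) A)
    (N : ℕ → CStarMatrix (Fin k) (Fin k) A) (hN : ∀ n, IsMatPos (N n))
    (h : ∀ i j, Tendsto (fun n => N n i j) atTop (𝓝 (M i j))) : IsMatPos M := by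
  have h' : Tendsto N atTop (𝓝 M) := tendsto_pi_nhds.2 fun i => tendsto_pi_nhds.2 fun j => h i j
  exact CStarAlgebra.isClosed_nonneg.mem_of_tendsto h' (Eventually.of_forall hN)

theorem conjTranspose_diagonal_mul_mul_diagonal (b : A) (M : Matrix (Fin k) (Fin k) A)
    (i j : Fin k) :
    ((Matrix.diagonal fun _ : Fin k => b).conjTranspose * M *
      Matrix.diagonal fun _ : Fin k => b) i j = star b * M i j * b := by
  rw [Matrix.diagonal_conjTranspose, Matrix.mul_diagonal, Matrix.diagonal_mul]
  rfl

/-- Since √c commutes with the entries, cM = S*MS for the diagonal matrix S with entries √c. -/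
theorem IsMatPos.mul_of_commute {M : CStarMatrix (Fin k) (Fin k) A} (hM : IsMatPos M) {c : A}
    (hc : IsPos c) (hcM : ∀ i j, Commute c (M i j)) : IsMatPos (M.map fun a => c * a) := by
  let b := CFC.sqrt c
  have hb : b * b = c := CFC.sqrt_mul_sqrt_self c hc
  have hbs : star b = b := (IsSelfAdjoint.of_nonneg (CFC.sqrt_nonneg c)).star_eq
  have hbM i j : Commute b (M i j) := by
    change Commute (cfcₙ _ c) _
    exact (hcM i j).cfcₙ_nnreal _
  let S : CStarMatrix (Fin k) (Fin k) A := CStarMatrix.ofMatrix (Matrix.diagonal fun _ => b)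
  have h : star S * M * S = M.map fun a => c * a := by
    ext i j
    refine (conjTranspose_diagonal_mul_mul_diagonal b M i j).trans ?_
    rw [hbs, mul_assoc, ← (hbM i j).eq, ← mul_assoc, hb]
    rfl
  rw [← h]
  exact star_left_conjugate_nonneg (show 0 ≤ M from hM) S

end Matrix

theorem continuous_starAlgEquiv {A B : Type*} [CStarAlgebra A] [CStarAlgebra B] (e : A ≃⋆ₐ[ℂ] B) :
    Continuous e :=
  AddMonoidHomClass.continuous_of_bound e 1 fun a => by
    rw [one_mul]; exact NonUnitalStarAlgHom.norm_apply_le e a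

/-! ### Partitions of unity and Riemann sums. -/

section Partition

variable {X : Type*} [TopologicalSpace X] [CompactSpace X]

theorem isPos_ofReal {f : C(X, ℝ)} (hf : ∀ x, 0 ≤ f x) :
    IsPos (⟨fun x => ((f x : ℝ) : ℂ), by fun_prop⟩ : C(X, ℂ)) := by
  convert isPos_star_mul_self (⟨fun x => ((√(f x) : ℝ) : ℂ), by fun_prop⟩ : C(X, ℂ)) using 1
  ext x
  simp [← Complex.ofReal_mul, Real.mul_self_sqrt (hf x)]

/-- Riemann sums over a partition of unity approximate a continuous function uniformly. -/
theorem exists_partition_approx [NormalSpace X] {E : Type*} [NormedAddCommGroup E] [NormedSpace ℂ E] (F : X → E)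
    (hF : Continuous F) {ε : ℝ} (hε : 0 < ε) :
    ∃ (s : Finset X) (p : s → C(X, ℂ)), (∀ i, IsPos (p i)) ∧ ∑ i, p i = 1 ∧
      ∀ x, ‖F x - ∑ i, p i x • F i‖ ≤ ε := by
  let U : X → Set X := fun x => F ⁻¹' Metric.ball (F x) ε
  have hU : ∀ x, IsOpen (U x) := fun x => Metric.isOpen_ball.preimage hF
  have hcov : (Set.univ : Set X) ⊆ ⋃ x, U x := fun x _ =>
    Set.mem_iUnion.2 ⟨x, Metric.mem_ball_self hε⟩
  obtain ⟨s, hs⟩ := isCompact_univ.elim_finite_subcover U hU hcov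
  obtain ⟨p, hp⟩ := PartitionOfUnity.exists_isSubordinate_of_locallyFinite isClosed_univ
    (fun x : s => U x) (fun x => hU x) (locallyFinite_of_finite _) (fun x hx => by
      have := hs hx
      simp only [Set.mem_iUnion] at this ⊢
      obtain ⟨y, hy, hxy⟩ := this
      exact ⟨⟨y, hy⟩, hxy⟩)
  have hsum (h : X) : ∑ i : s, p i h = 1 := by
    rw [← finsum_eq_sum_of_fintype]; exact p.sum_eq_one (Set.mem_univ h)
  refine ⟨s, fun i => ⟨fun h => ((p i h : ℝ) : ℂ), by fun_prop⟩,
    fun i => isPos_ofReal fun x => p.nonneg i x, ?_, fun h => ?_⟩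
  · ext h
    simpa [ContinuousMap.sum_apply, ← Complex.ofReal_sum] using hsum h
  have hF : F h = ∑ i : s, ((p i h : ℝ) : ℂ) • F h := by
    rw [← Finset.sum_smul, ← Complex.ofReal_sum, hsum]; simp
  have hd : F h - ∑ i : s, ((p i h : ℝ) : ℂ) • F i =
      ∑ i : s, ((p i h : ℝ) : ℂ) • (F h - F i) := by
    simp only [smul_sub, Finset.sum_sub_distrib, ← hF]
  change ‖F h - ∑ i : s, ((p i h : ℝ) : ℂ) • F i‖ ≤ ε
  rw [hd]
  calc ‖∑ i : s, ((p i h : ℝ) : ℂ) • (F h - F i)‖ ≤ ∑ i : s, p i h * ε := by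
        refine (norm_sum_le _ _).trans (Finset.sum_le_sum fun i _ => ?_)
        rw [norm_smul, Complex.norm_real, Real.norm_eq_abs, abs_of_nonneg (p.nonneg i h)]
        by_cases h0 : p i h = 0
        · simp [h0]
        · have hm : h ∈ U i := hp i (subset_tsupport _ h0)
          have hlt : dist (F h) (F i) < ε := hm
          rw [dist_eq_norm] at hlt
          exact mul_le_mul_of_nonneg_left hlt.le (p.nonneg i h)
    _ = ε := by rw [← Finset.sum_mul, hsum, one_mul]

end Partition

/-! ### Extending f ⊗ a ↦ φ(f)ι(a) to C(G, A). -/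

section TensorExtension

theorem elemTensor_mul_elemTensor {G A : Type*} [TopologicalSpace G] [CStarAlgebra A]
    (f g : C(G, ℂ)) (a b : A) :
    elemTensor f a * elemTensor g b = elemTensor (f * g) (a * b) := by
  ext h
  simp [elemTensor, smul_smul, mul_comm]

variable {G A D : Type*} [Group G] [TopologicalSpace G] [IsTopologicalGroup G] [CompactSpace G]
  [CStarAlgebra A] [CStarAlgebra D]

theorem elemTensor_induction {p : C(G, A) → Prop} (hclosed : IsClosed {F | p F}) (hzero : p 0)
    (hadd : ∀ F K, p F → p K → p (F + K)) (helem : ∀ f a, p (elemTensor f a)) (F : C(G, A)) :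
    p F := by
  have h : Set.range (algTensorMap G A) ⊆ {F | p F} := by
    rintro _ ⟨t, rfl⟩
    induction t using TensorProduct.induction_on with
    | zero => rw [map_zero]; exact hzero
    | tmul f a => exact helem f a
    | add x y hx hy => rw [map_add]; exact hadd _ _ hx hy
  exact closure_minimal h hclosed (algTensorMap_denseRange F)

/-- The image of t is close to a Riemann sum Σ φ(p_i)ι(F(x_i)), whose norm is controlled by the
supremum norm of F. The error is small because φ is bounded and t has finitely many terms. -/
theorem norm_tensor_le (φ : C(G, ℂ) →ₗ[ℂ] D) (hφ : ∀ f, IsPos f → IsPos (φ f)) (ι : A →⋆ₐ[ℂ] D)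
    (hc : ∀ f a, Commute (φ f) (ι a)) (t : C(G, ℂ) ⊗[ℂ] A) :
    ‖(LinearMap.mul' ℂ D ∘ₗ TensorProduct.map φ (ι : A →ₗ[ℂ] D)) t‖ ≤
      4 * ‖φ 1‖ * ‖algTensorMap G A t‖ := by
  obtain ⟨C, hC0, hC⟩ := exists_bound_of_isPos φ hφ
  obtain ⟨S, rfl⟩ := TensorProduct.exists_finset t
  refine le_of_forall_pos_le_add fun ε hε => ?_
  -- The summand 1 only keeps the divisor in ε / K positive.
  set K := C * ∑ k ∈ S, ‖k.2‖ + 1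
  have hK : 0 < K := by positivity
  -- All coefficient functions are bundled into one map to ℂ^S, so that a single partition serves
  -- them simultaneously.
  obtain ⟨s, p, hp, hp1, hpF⟩ := exists_partition_approx (fun h : G => fun k : S => k.1.1 h)
    (by fun_prop) (div_pos hε hK)
  set F := algTensorMap G A (∑ k ∈ S, k.1 ⊗ₜ[ℂ] k.2)
  have hF (x : G) : F x = ∑ k ∈ S, k.1 x • k.2 := by
    simp [F, algTensorMap_tmul, elemTensor, ContinuousMap.sum_apply]
  have h1 : ‖∑ i : s, φ (p i) * ι (F i)‖ ≤ 4 * ‖φ 1‖ * ‖F‖ := by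
    have := norm_sum_mul_map_le ι Finset.univ (fun i => φ (p i)) (fun i : s => F i)
      (fun i => hφ _ (hp i)) (fun i a => hc _ a) (norm_nonneg F) fun i => F.norm_coe_le_norm i
    rwa [← map_sum, hp1] at this
  have h2 : (LinearMap.mul' ℂ D ∘ₗ TensorProduct.map φ (ι : A →ₗ[ℂ] D))
      (∑ k ∈ S, k.1 ⊗ₜ[ℂ] k.2) = ∑ i : s, φ (p i) * ι (F i) +
        ∑ k ∈ S, φ (k.1 - ∑ i : s, k.1 i • p i) * ι k.2 := by
    simp only [hF, map_sum, map_sub, sub_mul, Finset.sum_sub_distrib, map_smul, Finset.mul_sum,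
      Finset.sum_mul, smul_mul_assoc, mul_smul_comm]
    rw [Finset.sum_comm, add_sub_cancel]
    simp
  rw [h2]
  refine (norm_add_le _ _).trans (add_le_add h1 ((norm_sum_le _ _).trans ?_))
  have h3 : ∀ k ∈ S, ‖φ (k.1 - ∑ i : s, k.1 i • p i) * ι k.2‖ ≤ C * (ε / K) * ‖k.2‖ := by
    intro k hk
    refine (norm_mul_le _ _).trans (mul_le_mul ((hC _).trans (mul_le_mul_of_nonneg_left ?_ hC0))
      (NonUnitalStarAlgHom.norm_apply_le ι _) (norm_nonneg _) (by positivity))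
    refine (ContinuousMap.norm_le _ (by positivity)).2 fun x => ?_
    refine le_trans (le_of_eq ?_) ((norm_le_pi_norm _ (⟨k, hk⟩ : S)).trans (hpF x))
    simp [ContinuousMap.sum_apply, mul_comm]
  refine (Finset.sum_le_sum h3).trans ?_
  rw [← Finset.mul_sum]
  calc C * (ε / K) * ∑ k ∈ S, ‖k.2‖ = ε * ((C * ∑ k ∈ S, ‖k.2‖) / K) := by ring
    _ ≤ ε * 1 := by
      refine mul_le_mul_of_nonneg_left ((div_le_one hK).2 ?_) hε.le
      simp [K]
    _ = ε := mul_one ε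

/-- A positive map on `C(G)` and a *-homomorphism on `A` with commuting ranges induce a bounded
linear map on `C(G, A)`. -/
theorem exists_tensor_extension (φ : C(G, ℂ) →ₗ[ℂ] D) (hφ : ∀ f, IsPos f → IsPos (φ f))
    (ι : A →⋆ₐ[ℂ] D) (hc : ∀ f a, Commute (φ f) (ι a)) :
    ∃ Ψ : C(G, A) →L[ℂ] D, ∀ f a, Ψ (elemTensor f a) = φ f * ι a :=
  ⟨(LinearMap.mul' ℂ D ∘ₗ TensorProduct.map φ (ι : A →ₗ[ℂ] D)).extendOfNorm (algTensorMap G A),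
    fun f a => (LinearMap.extendOfNorm_eq (e := algTensorMap G A) algTensorMap_denseRange
      ⟨_, norm_tensor_le φ hφ ι hc⟩ (f ⊗ₜ[ℂ] a)).trans rfl⟩

variable (A) in
/-- Evaluation at a point as a *-homomorphism. -/
def evalHom (x : G) : C(G, A) →⋆ₐ[ℂ] A where
  toFun F := F x
  map_one' := rfl
  map_mul' _ _ := rfl
  map_zero' := rfl
  map_add' _ _ := rfl
  commutes' _ := rfl
  map_star' _ := rfl

/-- Such a map is completely positive. -/
theorem isMatPos_map_tensor_extension (φ : C(G, ℂ) →ₗ[ℂ] D) (hφ : ∀ f, IsPos f → IsPos (φ f))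
    (ι : A →⋆ₐ[ℂ] D) (hc : ∀ f a, Commute (φ f) (ι a)) (Ψ : C(G, A) →L[ℂ] D)
    (hΨ : ∀ f a, Ψ (elemTensor f a) = φ f * ι a) {k : ℕ}
    {M : CStarMatrix (Fin k) (Fin k) C(G, A)} (hM : IsMatPos M) :
    IsMatPos (M.map (Ψ : C(G, A) →ₗ[ℂ] D)) := by
  have hε (n : ℕ) : (0 : ℝ) < 1 / (n + 1) := Nat.one_div_pos_of_nat
  choose s p hp hp1 hpF using fun n : ℕ => exists_partition_approx
    (fun h : G => fun ij : Fin k × Fin k => M ij.1 ij.2 h) (by fun_prop) (hε n)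
  -- The approximants are Σ φ(p_i)ι(M(x_i)): evaluation and ι preserve positive matrices, and the
  -- positive φ(p_i) commutes with the entries. Plain positivity of φ suffices.
  refine IsMatPos.of_tendsto _ (fun n => ∑ i : s n, (M.map (ι.comp (evalHom A (i : G)))).map
    fun a => φ (p n i) * a) (fun n => ?_) fun a b => ?_
  · exact IsMatPos.sum _ _ fun i _ => (hM.map _).mul_of_commute (hφ _ (hp n i))
      fun a b => hc _ _
  · have hentry (n : ℕ) : (∑ i : s n, (M.map (ι.comp (evalHom A (i : G)))).map fun x => φ (p n i) * x :
        CStarMatrix (Fin k) (Fin k) D) a b = Ψ (∑ i : s n, elemTensor (p n i) (M a b i)) := by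
      rw [map_sum, sum_cstarMatrix_apply]
      exact Finset.sum_congr rfl fun i _ => (hΨ _ _).symm
    simp only [hentry]
    refine (Ψ.continuous.tendsto _).comp ?_
    rw [tendsto_iff_norm_sub_tendsto_zero]
    refine squeeze_zero (fun _ => norm_nonneg _) (fun n => ?_) tendsto_one_div_add_atTop_nhds_zero_nat
    refine (ContinuousMap.norm_le _ (hε n).le).2 fun x => ?_
    rw [ContinuousMap.sub_apply, norm_sub_rev, ContinuousMap.sum_apply]
    refine le_trans (le_of_eq ?_) ((norm_le_pi_norm _ (a, b)).trans (hpF n x))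
    simp [elemTensor]

/-- Both sides are bilinear and continuous, so elementary tensors suffice; there the identity for φ
on the commutative C(G) applies. Orthogonality preservation of Ψ is the case FK = 0. -/
theorem tensor_extension_mul (φ : C(G, ℂ) →ₗ[ℂ] D) (hφ : ∀ f, IsPos f → IsPos (φ f))
    (hφ' : ∀ f g, IsPos f → IsPos g → f * g = 0 → g * f = 0 → φ f * φ g = 0)
    (ι : A →⋆ₐ[ℂ] D) (hc : ∀ f a, Commute (φ f) (ι a)) (Ψ : C(G, A) →L[ℂ] D)
    (hΨ : ∀ f a, Ψ (elemTensor f a) = φ f * ι a) (F K : C(G, A)) :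
    Ψ F * Ψ K = φ 1 * Ψ (F * K) := by
  induction F using elemTensor_induction with
  | hclosed => exact isClosed_eq (by fun_prop) (by fun_prop)
  | hzero => simp
  | hadd F₁ F₂ h₁ h₂ => simp only [map_add, add_mul, mul_add, h₁, h₂]
  | helem f a =>
    induction K using elemTensor_induction with
    | hclosed => exact isClosed_eq (by fun_prop) (by fun_prop)
    | hzero => simp
    | hadd F₁ F₂ h₁ h₂ => simp only [map_add, mul_add, h₁, h₂]
    | helem g b =>
      have h := map_mul_map_of_forall_commute φ hφ hφ' (StarAlgHom.id ℂ C(G, ℂ))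
        (StarAlgHom.id ℂ C(G, ℂ)) (fun p q => mul_comm _ _) f g
      simp only [StarAlgHom.coe_id, id_eq] at h
      rw [elemTensor_mul_elemTensor, hΨ, hΨ, hΨ, mul_assoc, ← mul_assoc (ι a), ← (hc g a).eq,
        mul_assoc, ← map_mul, ← mul_assoc, h, mul_assoc]

end TensorExtension

/-! ### Constant sequences as a *-homomorphism. -/

section Constants

variable {G A : Type*} [Group G] [TopologicalSpace G] [CStarAlgebra A] (ω : Ultrafilter ℕ)

variable (A) in
/-- The embedding of `A` into its ultrapower as a *-homomorphism. -/
def constHom : A →⋆ₐ[ℂ] Ultrapower ω A where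
  toFun := Ultrapower.const ω
  map_one' := rfl
  map_mul' _ _ := rfl
  map_zero' := rfl
  map_add' _ _ := rfl
  commutes' _ := rfl
  map_star' _ := rfl

theorem Action.ultra_constHom (α : Action G A) (g : G) (a : A) :
    α.ultra ω g (constHom A ω a) = constHom A ω (α g a) := rfl

end Constants

/-! ### The two implications. -/

section Corollary

variable {ω : Ultrafilter ℕ} {G A : Type*} [Group G] [TopologicalSpace G] [IsTopologicalGroup G]
  [CompactSpace G] [CStarAlgebra A] {α : Action G A}

theorem oneTensorId_equivariant (g : G) (a : A) :
    oneTensorId G A (α g a) = tensorAction α g (oneTensorId G A a) := by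
  change elemTensor 1 (α g a) = tensorAction α g (elemTensor 1 a)
  rw [tensorAction_elemTensor]
  rfl

theorem HasWeakTracialRokhlin.isTraciallySequentiallySplit (h : HasWeakTracialRokhlin ω α) :
    IsTraciallySequentiallySplit ω α (tensorAction α) (oneTensorId G A) := by
  refine ⟨oneTensorId_equivariant, fun x hx hx0 => ?_⟩
  obtain ⟨φ, -, hequiv, hle⟩ := h x hx hx0
  let φ' : C(G, ℂ) →ₗ[ℂ] Ultrapower ω A :=
    (Ultrapower.central ω A).subtype.toAlgHom.toLinearMap ∘ₗ φ.asLinearMap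
  have hφ (f : C(G, ℂ)) (hf : IsPos f) : IsPos (φ' f) :=
    (φ.isPos_map hf).map (Ultrapower.central ω A).subtype
  have hφ' (f g : C(G, ℂ)) (hf : IsPos f) (hg : IsPos g) (hfg : f * g = 0) (hgf : g * f = 0) :
      φ' f * φ' g = 0 :=
    congrArg Subtype.val (φ.map_orthogonal' f g hf hg hfg hgf).1
  have hc (f : C(G, ℂ)) (a : A) : Commute (φ' f) (constHom A ω a) :=
    ((Ultrapower.mem_central ω).1 (φ f).2 a).symm
  obtain ⟨Ψ, hΨ⟩ := exists_tensor_extension φ' hφ (constHom A ω) hc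
  refine ⟨OrderZeroMap.ofLinearMap Ψ
    (fun k M hM => isMatPos_map_tensor_extension φ' hφ _ hc Ψ hΨ hM)
    (fun F K _ _ hFK _ => ?_), φ' 1, fun g F => ?_, hφ 1 ?_, (φ 1).2, fun a => ⟨?_, ?_⟩, hle⟩
  · change Ψ F * Ψ K = 0
    rw [tensor_extension_mul φ' hφ hφ' _ hc Ψ hΨ, hFK, map_zero, mul_zero]
  · change Ψ (tensorAction α g F) = α.ultra ω g (Ψ F)
    induction F using elemTensor_induction with
    | hclosed =>
      exact isClosed_eq
        (Ψ.continuous.comp (continuous_starAlgEquiv (tensorAction α g)))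
        ((continuous_starAlgEquiv (α.ultra ω g)).comp Ψ.continuous)
    | hzero => simp
    | hadd F₁ F₂ h₁ h₂ => simp only [map_add, h₁, h₂]
    | helem f a =>
      rw [tensorAction_elemTensor, hΨ, hΨ, map_mul, Action.ultra_constHom]
      exact congrArg (· * _) (congrArg Subtype.val (hequiv g f))
  · simpa using isPos_star_mul_self (1 : C(G, ℂ))
  · exact hΨ 1 a
  · exact (hΨ 1 a).trans (hc 1 a).eq

variable (G A) in
/-- The *-homomorphism `f ↦ f ⊗ 1` from `C(G)` to `C(G, A)`. -/
def tensorOneHom : C(G, ℂ) →⋆ₐ[ℂ] C(G, A) where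
  toFun f := elemTensor f 1
  map_one' := by ext; simp [elemTensor]
  map_mul' f g := by ext; simp [elemTensor, smul_smul, mul_comm]
  map_zero' := by ext; simp [elemTensor]
  map_add' f g := by ext; simp [elemTensor, add_smul]
  commutes' c := by ext; simp [elemTensor, Algebra.algebraMap_eq_smul_one]
  map_star' f := by ext; simp [elemTensor]

variable (G A) in
/-- The unital *-homomorphism `a ↦ 1 ⊗ a`. -/
def oneTensorHom : A →⋆ₐ[ℂ] C(G, A) where
  toFun a := elemTensor 1 a
  map_one' := by ext; simp [elemTensor]
  map_mul' a b := by ext; simp [elemTensor]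
  map_zero' := by ext; simp [elemTensor]
  map_add' a b := by ext; simp [elemTensor]
  commutes' c := by ext; simp [elemTensor, Algebra.algebraMap_eq_smul_one]
  map_star' a := by ext; simp [elemTensor]

theorem commute_tensorOneHom_oneTensorHom (f : C(G, ℂ)) (a : A) :
    Commute (tensorOneHom G A f) (oneTensorHom G A a) := by
  change elemTensor f 1 * elemTensor 1 a = elemTensor 1 a * elemTensor f 1
  simp only [elemTensor_mul_elemTensor, one_mul, mul_one]

theorem IsTraciallySequentiallySplit.hasWeakTracialRokhlin
    (h : IsTraciallySequentiallySplit ω α (tensorAction α) (oneTensorId G A)) :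
    HasWeakTracialRokhlin ω α := by
  intro x hx hx0
  obtain ⟨ψ, e, hequiv, he, heA, hψ, hle⟩ := h.2 x hx hx0
  let T : C(G, A) →ₗ[ℂ] Ultrapower ω A := ψ.asLinearMap
  have hT (F : C(G, A)) (hF : IsPos F) : IsPos (T F) := ψ.isPos_map hF
  have hT' (F K : C(G, A)) (hF : IsPos F) (hK : IsPos K) (h1 : F * K = 0) (h2 : K * F = 0) :
      T F * T K = 0 := (ψ.map_orthogonal' F K hF hK h1 h2).1
  have hTa (a : A) : T (oneTensorHom G A a) = e * constHom A ω a := (hψ a).1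
  have hT1 : T 1 = e := by rw [← map_one (oneTensorHom G A), hTa, map_one, mul_one]
  have heA' (a : A) : Commute e (constHom A ω a) := ((Ultrapower.mem_central ω).1 heA a).symm
  let φ₀ : C(G, ℂ) →ₗ[ℂ] Ultrapower ω A := T ∘ₗ (tensorOneHom G A).toAlgHom.toLinearMap
  have hφ₀ (f : C(G, ℂ)) : φ₀ f = T (tensorOneHom G A f) := rfl
  have hφ1 : φ₀ 1 = e := by rw [hφ₀, map_one, hT1]
  have hφpos (f : C(G, ℂ)) (hf : IsPos f) : IsPos (φ₀ f) := hT _ (hf.map (tensorOneHom G A))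
  have hφorth (f g : C(G, ℂ)) (hf : IsPos f) (hg : IsPos g) (h1 : f * g = 0) (h2 : g * f = 0) :
      φ₀ f * φ₀ g = 0 :=
    hT' (tensorOneHom G A f) (tensorOneHom G A g) (hf.map (tensorOneHom G A)) (hg.map (tensorOneHom G A)) (by rw [← map_mul, h1, map_zero])
      (by rw [← map_mul, h2, map_zero])
  have hcomm (F : C(G, A)) : Commute (T F) e := hT1 ▸ commute_map_map_one T hT hT' F
  have hcentral (f : C(G, ℂ)) : φ₀ f ∈ Ultrapower.central ω A := by
    rw [Ultrapower.mem_central]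
    intro a
    change constHom A ω a * φ₀ f = φ₀ f * constHom A ω a
    set b := constHom A ω a
    -- Since e b = T(1 ⊗ a), the identity for T, used on f ⊗ 1 and 1 ⊗ a in both orders, gives the
    -- same right-hand side.
    have h1 : φ₀ f * (e * b) = e * T (tensorOneHom G A f * oneTensorHom G A a) := by
      rw [← hTa, hφ₀, ← hT1]
      exact map_mul_map_of_forall_commute T hT hT' _ _ commute_tensorOneHom_oneTensorHom f a
    have h2 : e * b * φ₀ f = e * T (tensorOneHom G A f * oneTensorHom G A a) := by
      rw [← hTa, hφ₀, ← hT1, (commute_tensorOneHom_oneTensorHom f a).eq]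
      exact map_mul_map_of_forall_commute T hT hT' _ _
        (fun a f => (commute_tensorOneHom_oneTensorHom f a).symm) a f
    set z := b * φ₀ f - φ₀ f * b
    have hcφ : Commute (φ₀ f) e := hcomm _
    have hz : e * z = 0 := by
      rw [mul_sub, ← mul_assoc, h2, ← h1, ← mul_assoc, hcφ.eq, mul_assoc, sub_self]
    have hann (w : Ultrapower ω A) (hw : e * w = 0) (F : C(G, A)) : T F * w = 0 :=
      map_mul_eq_zero_of_map_one_mul T hT (hT1 ▸ hw) F
    have hstar : star (φ₀ f) = T (tensorOneHom G A (star f)) := by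
      rw [map_star, map_star_of_isPos T hT, hφ₀]
    have hstarz : e * (star b * z) = 0 := by
      rw [← map_star, ← mul_assoc, (heA' _).eq, mul_assoc, hz, mul_zero]
    -- In φ(f)* b* z - b* φ(f)* z both terms vanish: φ(f)* is a value of T, and e annihilates z as
    -- well as b* z.
    have hzz : star z * z = 0 := by
      rw [star_sub, star_mul, star_mul, sub_mul, mul_assoc, mul_assoc, hstar, hann _ hstarz,
        hann _ hz, mul_zero, sub_zero]
    exact sub_eq_zero.1 ((CStarRing.star_mul_self_eq_zero_iff z).1 hzz)
  let φ : C(G, ℂ) →ₗ[ℂ] Ultrapower.central ω A :=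
    { toFun f := ⟨φ₀ f, hcentral f⟩
      map_add' f g := Subtype.ext (map_add φ₀ f g)
      map_smul' c f := Subtype.ext (map_smul φ₀ c f) }
  have hemb : Function.Injective (Ultrapower.central ω A).subtype := Subtype.val_injective
  refine ⟨OrderZeroMap.ofLinearMap φ
    -- Matrix positivity holds in the ultrapower and is reflected by the inclusion of the central
    -- subalgebra.
    (fun k M hM => IsMatPos.of_map _ hemb (ψ.isMatPos_map (hM.map (tensorOneHom G A))))
    (fun f g hf hg h1 h2 => Subtype.ext (hφorth f g hf hg h1 h2)), fun f => ?_, fun g f => ?_, ?_⟩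
  · change ‖φ₀ f‖ ≤ ‖f‖
    have he1 : ‖e‖ ≤ 1 := he.norm_le_one hle.1
    -- The C*-identity then reduces contractivity to the positive element f*f, where ‖φ(f*f)‖ ≤
    -- ‖f‖²‖e‖.
    have hmul : star (φ₀ f) * φ₀ f = e * φ₀ (star f * f) := by
      rw [← map_star_of_isPos φ₀ hφpos, ← hφ1]
      exact map_mul_map_of_forall_commute φ₀ hφpos hφorth (StarAlgHom.id ℂ C(G, ℂ))
        (StarAlgHom.id ℂ C(G, ℂ)) (fun p q => mul_comm _ _) (star f) f
    have hbound := norm_map_le_of_isPos φ₀ hφpos (isPos_star_mul_self f)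
    rw [hφ1, CStarRing.norm_star_mul_self] at hbound
    refine le_of_sq_le_sq ?_ (norm_nonneg f)
    calc ‖φ₀ f‖ ^ 2 = ‖e * φ₀ (star f * f)‖ := by rw [← hmul, CStarRing.norm_star_mul_self, sq]
      _ ≤ ‖e‖ * (‖f‖ * ‖f‖ * ‖e‖) :=
        (norm_mul_le _ _).trans (mul_le_mul_of_nonneg_left hbound (norm_nonneg e))
      _ ≤ 1 * (‖f‖ * ‖f‖ * 1) := by gcongr
      _ = ‖f‖ ^ 2 := by ring
  · refine Subtype.ext ?_
    change T (elemTensor (shift G g f) 1) = α.ultra ω g (T (elemTensor f 1))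
    have hshift : elemTensor (shift G g f) (1 : A) = tensorAction α g (elemTensor f 1) := by
      rw [tensorAction_elemTensor, map_one]
    rw [hshift]
    exact hequiv g _
  · change CuntzLE (1 - φ₀ 1) x
    rwa [hφ1]

end Corollary

end CStarDyn

end

theorem corollaryC (ω : Ultrafilter ℕ) (hω : (ω : Filter ℕ) ≤ Filter.cofinite)
    {G : Type*} [Group G] [TopologicalSpace G] [IsTopologicalGroup G] [CompactSpace G]
    {A : Type*} [CStarAlgebra A] [TopologicalSpace.SeparableSpace A]
    (α : CStarDyn.Action G A) :
    CStarDyn.HasWeakTracialRokhlin ω α ↔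
      CStarDyn.IsTraciallySequentiallySplit ω α (CStarDyn.tensorAction α)
        (CStarDyn.oneTensorId G A) :=
  ⟨fun h => h.isTraciallySequentiallySplit, fun h => h.hasWeakTracialRokhlin⟩
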